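/- Let $1\le p\le q\le n-1$ and $d\ge 1$ be integers, let $U\subset\mathbb C^n$ be a nonempty open set with coordinates $x_1,\dots,x_n$, and let $\mathcal W=(\mathcal F_1,\dots,\mathcal F_d)$ be a family of $d$ holomorphic foliations of codimension $q$ on $U$ (a $d$-web of codimension $q$; no general position condition is needed here). *Ranks.* A holomorphic $p$-form $\omega$ is $\mathcal F$-basic if $i_X\omega=0$ and $L_X\omega=0$ for all $X$ tangent to $\mathcal F$. A germ of $p$-abelian relation of $\mathcal W$ at $m\in U$ is a family $(\omega_1,\dots,\omega_d)$ of germs at $m$ of holomorphic $p$-forms such that $\omega_i$ is $\mathcal F_i$-basic and $\sum_i\omega_i=0$; it is closed if all $d\omega_i=0$. The $p$-rank $r_p(\mathcal W)$ (resp. closed $p$-rank $\widetilde r_p(\mathcal W)$) is the supremum over $m\in U$ of the dimension, possibly infinite, of the complex vector space of germs at $m$ of $p$-abelian relations (resp. closed ones). *Numbers.* Let $b(r,s)=\binom rs$, let $c(r,h)=\binom{r-1+h}{h}$ (and $c(r,h)=0$ for $h<0$), let $z(r,p,k)=\sum_{j=p}^{r}(-1)^{p-j}b(r,j)\,c(r,k+p-j)$,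 let $a^+=\max(a,0)$, and let $$\pi^0_p(n,d,q)=b(q,p)\sum_{h\ge0}c(q,h)\Bigl(d-\tfrac{b(n,p)\,c(n,h)}{b(q,p)\,c(q,h)}\Bigr)^+,\qquad \pi'_p(n,d,q)=\sum_{h\ge0}z(q,p,h)\Bigl(d-\tfrac{z(n,p,h)}{z(q,p,h)}\Bigr)^+.$$ These sums have finitely many nonzero terms. *Ordinary webs.* Near $m\in U$ choose for each $i$ a generating system $u_i=(u_{i,1},\dots,u_{i,q})$ of $\mathcal F_i$-basic functions (holomorphic functions constant along $\mathcal F_i$ with $du_{i,1}\wedge\dots\wedge du_{i,q}\ne0$). For $A=(\alpha_1<\dots<\alpha_p)$ in $\{1,\dots,q\}$ and $B=(\lambda_1<\dots<\lambda_p)$ in $\{1,\dots,n\}$ let $J^A_{i,B}=\det(\partial u_{i,\alpha_r}/\partial x_{\lambda_s})_{r,s}$. For multi-indices $L\in\mathbb N^n$, $K\in\mathbb N^q$ let $M^{i,A,K}_{B,L}$ be the functions such that $$\partial_L\bigl((f\circ u_i)\,J^A_{i,B}\bigr)=\sum_{|K|\le|L|}M^{i,A,K}_{B,L}\,\bigl((\partial_Kf)\circ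 u_i\bigr)$$ for every holomorphic function $f$ of $q$ variables. For $k\ge0$ let $P_k$ be the matrix of the values $M^{i,A,K}_{B,L}(m)$ with $|K|=|L|=k$, with rows $(B,L)$ and columns $(i,A,K)$. The web is $p$-ordinary if for every $m\in U$ and every $k\ge0$ one has $\operatorname{rank}P_k=\min\bigl(b(n,p)c(n,k),\,d\,b(q,p)c(q,k)\bigr)$. Let $\widetilde P_k$ be the restriction of $P_k$ to the vectors $(w_{i,A,K})$ such that, for every $i$, $(w_{i,A,K})_{A,K}$ lies in the kernel of the Koszul differential $S^k(\mathbb C^q)^*\otimes\Lambda^p(\mathbb C^q)^*\to S^{k-1}(\mathbb C^q)^*\otimes\Lambda^{p+1}(\mathbb C^q)^*$, where $w_{i,A,K}$ stands for the derivative $\partial_Kf_{i,A}$ of a coefficient of the form $\sum_Af_{i,A}\,dy_A$ (for $k=0$ there is no condition). The web is strongly $p$-ordinary if for every $m\in U$ and every $k\ge0$ one has $\operatorname{rank}\widetilde P_k=\min\bigl(z(n,p,k),\,d\,z(q,p,k)\bigr)$. These conditions do not depend on the choice of the $u_i$. *Theorem.* Suppose that $\mathcal W$ is parallelizable: near every point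 of $U$ there are holomorphic local coordinates and generating systems $u_i$ of $\mathcal F_i$-basic functions such that all the $u_{i,\alpha}$ are affine functions of these coordinates. Then: 1. if $\mathcal W$ is $p$-ordinary, then $r_p(\mathcal W)=\pi^0_p(n,d,q)$; if $\mathcal W$ is not $p$-ordinary, then $r_p(\mathcal W)>\pi^0_p(n,d,q)$; 2. if $\mathcal W$ is strongly $p$-ordinary, then $\widetilde r_p(\mathcal W)=\pi'_p(n,d,q)$; if $\mathcal W$ is not strongly $p$-ordinary, then $\widetilde r_p(\mathcal W)>\pi'_p(n,d,q)$. -/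

import Mathlib

open scoped Topology

noncomputable section

namespace AbelianWeb

/-! ### Foliations, webs, parallelizable webs -/

/-- `ℂʳ`, with its standard coordinates. -/
abbrev Cn (r : ℕ) : Type := Fin r → ℂ

/-- `u = (u₁, …, u_q)` is, on a neighbourhood of `m`, a generating system of basic functions of the
foliation with tangent spaces `T`: the map `u` is holomorphic near `m`, its differentials
`du₁, …, du_q` are linearly independent, and they vanish exactly on the tangent spaces. -/
def IsSystemAt {n q : ℕ} (T : Cn n → Submodule ℂ (Cn n)) (u : Cn n → Cn q) (m : Cn n) : Prop :=
  ∀ᶠ x in 𝓝 m, DifferentiableAt ℂ u x ∧ Function.Surjective (fderiv ℂ u x) ∧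
    LinearMap.ker (fderiv ℂ u x).toLinearMap = T x

/-- A holomorphic foliation of codimension `q` on `U ⊆ ℂⁿ`: a field of tangent spaces that is
locally the field of kernels of the differential of a holomorphic submersion onto an open set of
`ℂ^q`. The values of `tangent` outside `U` play no role. -/
structure Foliation (n q : ℕ) (U : Set (Cn n)) where
  tangent : Cn n → Submodule ℂ (Cn n)
  exists_system : ∀ m ∈ U, ∃ u : Cn n → Cn q, IsSystemAt tangent u m

/-- A (completely decomposed) `d`-web of codimension `q` on `U`: a family of `d` foliations. No
condition of general position is imposed. -/
abbrev Web (d n q : ℕ) (U : Set (Cn n)) : Type := Fin d → Foliation n q U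

/-- `u` is a choice, near `m`, of a generating system of basic functions for every foliation. -/
def Web.IsSystem {d n q : ℕ} {U : Set (Cn n)} (W : Web d n q U) (u : Fin d → Cn n → Cn q)
    (m : Cn n) : Prop :=
  ∀ i, IsSystemAt (W i).tangent (u i) m

/-- Near every point of `U` there are holomorphic coordinates `φ` and generating systems of basic
functions of the foliations which are all affine functions of these coordinates. -/
def Web.IsParallelizable {d n q : ℕ} {U : Set (Cn n)} (W : Web d n q U) : Prop :=
  ∀ m ∈ U, ∃ φ : OpenPartialHomeomorph (Cn n) (Cn n), m ∈ φ.source ∧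
    DifferentiableOn ℂ φ φ.source ∧ DifferentiableOn ℂ φ.symm φ.target ∧
    ∃ a : Fin d → (Cn n →ᵃ[ℂ] Cn q), W.IsSystem (fun i x => a i (φ x)) m

/-! ### Basic forms, abelian relations, ranks -/

/-- Differential `p`-forms on (open sets of) `ℂⁿ`. -/
abbrev Form (n p : ℕ) : Type := Cn n → Cn n [⋀^Fin p]→L[ℂ] ℂ

/-- The interior products `i_v η` vanish for all `v ∈ S`. -/
def Kills {n r : ℕ} (S : Submodule ℂ (Cn n)) (η : Cn n [⋀^Fin r]→L[ℂ] ℂ) : Prop :=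
  ∀ w : Fin r → Cn n, (∃ j, w j ∈ S) → η w = 0

/-- The conditions at the point `x` for `ω` to be a holomorphic basic form of the foliation with
tangent spaces `T`: `i_X ω = 0` (semi-basic) and `L_X ω = i_X dω + d (i_X ω) = i_X dω = 0`
(invariant) for all `X` tangent to the foliation. -/
def IsBasicAt {n p : ℕ} (T : Cn n → Submodule ℂ (Cn n)) (ω : Form n p) (x : Cn n) : Prop :=
  DifferentiableAt ℂ ω x ∧ Kills (T x) (ω x) ∧ Kills (T x) (extDeriv ω x)

theorem Kills.zero {n r : ℕ} (S : Submodule ℂ (Cn n)) :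
    Kills S (0 : Cn n [⋀^Fin r]→L[ℂ] ℂ) := fun _ _ => rfl

theorem Kills.add {n r : ℕ} {S : Submodule ℂ (Cn n)} {η θ : Cn n [⋀^Fin r]→L[ℂ] ℂ}
    (h : Kills S η) (h' : Kills S θ) : Kills S (η + θ) := fun w hw => by
  simp [h w hw, h' w hw]

theorem Kills.smul {n r : ℕ} {S : Submodule ℂ (Cn n)} {η : Cn n [⋀^Fin r]→L[ℂ] ℂ}
    (c : ℂ) (h : Kills S η) : Kills S (c • η) := fun w hw => by
  simp [h w hw]

theorem extDeriv_zero_form {n p : ℕ} (x : Cn n) : extDeriv (0 : Form n p) x = 0 := by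
  have h := extDeriv_smul (x := x) (0 : ℂ) (0 : Form n p)
  simpa using h

theorem IsBasicAt.zero {n p : ℕ} (T : Cn n → Submodule ℂ (Cn n)) (x : Cn n) :
    IsBasicAt T (0 : Form n p) x :=
  ⟨differentiableAt_const _, Kills.zero _, by rw [extDeriv_zero_form]; exact Kills.zero _⟩

theorem IsBasicAt.add {n p : ℕ} {T : Cn n → Submodule ℂ (Cn n)} {ω θ : Form n p} {x : Cn n}
    (h : IsBasicAt T ω x) (h' : IsBasicAt T θ x) : IsBasicAt T (ω + θ) x :=
  ⟨h.1.add h'.1, h.2.1.add h'.2.1, by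
    rw [extDeriv_add h.1 h'.1]; exact h.2.2.add h'.2.2⟩

theorem IsBasicAt.smul {n p : ℕ} {T : Cn n → Submodule ℂ (Cn n)} {ω : Form n p} {x : Cn n}
    (c : ℂ) (h : IsBasicAt T ω x) : IsBasicAt T (c • ω) x :=
  ⟨h.1.const_smul c, h.2.1.smul c, by rw [extDeriv_smul]; exact h.2.2.smul c⟩

/-- Germs at `m` of `p`-forms. -/
abbrev FormGerm (n p : ℕ) (m : Cn n) : Type :=
  (𝓝 m).Germ (Cn n [⋀^Fin p]→L[ℂ] ℂ)

/-- The vector space of germs at `m` of `p`-abelian relations: families `(ω_i)` of germs of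
holomorphic `p`-forms such that `ω_i` is basic for the `i`-th foliation and `∑ ω_i = 0`. -/
def Web.abelianRelations {d n q : ℕ} {U : Set (Cn n)} (W : Web d n q U) (p : ℕ) (m : Cn n) :
    Submodule ℂ (Fin d → FormGerm n p m) where
  carrier := {g | ∃ ω : Fin d → Form n p, (∀ i, g i = (ω i : FormGerm n p m)) ∧
    ∀ᶠ x in 𝓝 m, (∀ i, IsBasicAt (W i).tangent (ω i) x) ∧ ∑ i, ω i x = 0}
  zero_mem' := ⟨0, fun _ => rfl, .of_forall fun x => ⟨fun _ => .zero _ x, by simp⟩⟩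
  add_mem' := by
    rintro g g' ⟨ω, hg, hω⟩ ⟨ω', hg', hω'⟩
    refine ⟨ω + ω', fun i => by rw [Pi.add_apply, hg, hg']; rfl, ?_⟩
    filter_upwards [hω, hω'] with x h h'
    exact ⟨fun i => (h.1 i).add (h'.1 i), by simp [Finset.sum_add_distrib, h.2, h'.2]⟩
  smul_mem' := by
    rintro c g ⟨ω, hg, hω⟩
    refine ⟨c • ω, fun i => by rw [Pi.smul_apply, hg]; rfl, ?_⟩
    filter_upwards [hω] with x h
    exact ⟨fun i => (h.1 i).smul c, by simp [← Finset.smul_sum, h.2]⟩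

/-- The vector space of germs at `m` of closed `p`-abelian relations: all `ω_i` are closed. -/
def Web.closedAbelianRelations {d n q : ℕ} {U : Set (Cn n)} (W : Web d n q U) (p : ℕ)
    (m : Cn n) : Submodule ℂ (Fin d → FormGerm n p m) where
  carrier := {g | ∃ ω : Fin d → Form n p, (∀ i, g i = (ω i : FormGerm n p m)) ∧
    ∀ᶠ x in 𝓝 m, (∀ i, IsBasicAt (W i).tangent (ω i) x ∧ extDeriv (ω i) x = 0) ∧
      ∑ i, ω i x = 0}
  zero_mem' := ⟨0, fun _ => rfl, .of_forall fun x =>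
    ⟨fun _ => ⟨.zero _ x, extDeriv_zero_form x⟩, by simp⟩⟩
  add_mem' := by
    rintro g g' ⟨ω, hg, hω⟩ ⟨ω', hg', hω'⟩
    refine ⟨ω + ω', fun i => by rw [Pi.add_apply, hg, hg']; rfl, ?_⟩
    filter_upwards [hω, hω'] with x h h'
    refine ⟨fun i => ⟨(h.1 i).1.add (h'.1 i).1, ?_⟩,
      by simp [Finset.sum_add_distrib, h.2, h'.2]⟩
    rw [Pi.add_apply, extDeriv_add (h.1 i).1.1 (h'.1 i).1.1, (h.1 i).2, (h'.1 i).2, add_zero]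
  smul_mem' := by
    rintro c g ⟨ω, hg, hω⟩
    refine ⟨c • ω, fun i => by rw [Pi.smul_apply, hg]; rfl, ?_⟩
    filter_upwards [hω] with x h
    refine ⟨fun i => ⟨(h.1 i).1.smul c, ?_⟩, by simp [← Finset.smul_sum, h.2]⟩
    rw [Pi.smul_apply, extDeriv_smul, (h.1 i).2, smul_zero]

/-- The `p`-rank of the web: the supremum over `m ∈ U` of the dimension, possibly infinite, of the
space of germs at `m` of `p`-abelian relations. -/
def Web.pRank {d n q : ℕ} {U : Set (Cn n)} (W : Web d n q U) (p : ℕ) : ℕ∞ :=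
  ⨆ m ∈ U, Cardinal.toENat (Module.rank ℂ (W.abelianRelations p m))

/-- The closed `p`-rank of the web. -/
def Web.closedPRank {d n q : ℕ} {U : Set (Cn n)} (W : Web d n q U) (p : ℕ) : ℕ∞ :=
  ⨆ m ∈ U, Cardinal.toENat (Module.rank ℂ (W.closedAbelianRelations p m))

/-! ### The numbers `b`, `c`, `z` and the bounds `π⁰`, `π'` -/

/-- The binomial coefficient `b(r, s)`. -/
def b (r s : ℕ) : ℕ := r.choose s

/-- The dimension `c(r, h) = b(r - 1 + h, h)` of the space of homogeneous polynomials of degree `h`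
in `r` variables. -/
def c (r h : ℕ) : ℕ := b (r + h - 1) h

/-- `z(r, p, k) = ∑_{j = p}^{r} (-1)^{p - j} b(r, j) c(r, k + p - j)`, the terms of negative degree
`k + p - j` being zero. -/
def z (r p k : ℕ) : ℤ :=
  ∑ j ∈ (Finset.Icc p r).filter (fun j => j ≤ k + p),
    (-1) ^ (j - p) * ((b r j : ℤ) * (c r (k + p - j) : ℤ))

/-- `π⁰_p(n, d, q) = ∑_{h ≥ 0} (d b(q,p) c(q,h) - b(n,p) c(n,h))⁺`, where `a⁺ = max(a, 0)`. For
`1 ≤ q < n` only finitely many terms are nonzero. -/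
def piZero (p n d q : ℕ) : ℕ :=
  ∑ᶠ h : ℕ, ((d : ℤ) * (b q p * c q h : ℕ) - (b n p * c n h : ℕ)).toNat

/-- `π'_p(n, d, q) = ∑_{h ≥ 0} (d z(q,p,h) - z(n,p,h))⁺`. For `1 ≤ p ≤ q < n` only finitely many
terms are nonzero. -/
def piPrime (p n d q : ℕ) : ℕ :=
  ∑ᶠ h : ℕ, ((d : ℤ) * z q p h - z n p h).toNat

/-! ### The matrices `P_k` -/

/-- The set `S(r, k)` of multi-indices of degree `k` in `r` variables. -/
abbrev MultiIndex (r k : ℕ) : Type := {L : Fin r → ℕ // ∑ j, L j = k}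

instance (r k : ℕ) : Fintype (MultiIndex r k) :=
  Fintype.subtype (Finset.piAntidiag Finset.univ k) (by simp)

/-- The multi-index `L + 1_α`. -/
def MultiIndex.succ {r k : ℕ} (L : MultiIndex r k) (α : Fin r) : MultiIndex r (k + 1) :=
  ⟨L.1 + Pi.single α 1, by simp [Finset.sum_add_distrib, L.2]⟩

/-- A list of the variables of the derivation `∂_L`, the variable `λ` being repeated `L_λ` times. -/
def MultiIndex.toList {r k : ℕ} (L : MultiIndex r k) : List (Fin r) :=
  (List.finRange r).flatMap fun j => List.replicate (L.1 j) j

/-- The set of multi-indices `1 ≤ λ₁ < ⋯ < λ_p ≤ r`. -/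
abbrev Increasing (p r : ℕ) : Type := Fin p ↪o Fin r

instance (p r : ℕ) : Fintype (Increasing p r) :=
  Fintype.ofInjective (fun B : Increasing p r => (B : Fin p → Fin r)) DFunLike.coe_injective

/-- The partial derivative `∂g/∂x_l`. -/
def partialDeriv {n : ℕ} (l : Fin n) (g : Cn n → ℂ) (x : Cn n) : ℂ :=
  fderiv ℂ g x (Pi.single l 1)

/-- The coefficients `M_L^K` of the formula
`∂_L ((f ∘ u) J) = ∑_K M_L^K ((∂_K f) ∘ u)` (`f` an arbitrary holomorphic function of `q`
variables), computed by the recursion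
`M_{L + 1_l}^K = ∂_l M_L^K + ∑_{α, K_α > 0} M_L^{K - 1_α} ∂_l u_α`, where the derivation `∂_L` is
given by a list of variables. -/
def jetCoeff {n q : ℕ} (u : Cn n → Cn q) (J : Cn n → ℂ) :
    List (Fin n) → (Fin q → ℕ) → Cn n → ℂ
  | [], K => if K = 0 then J else 0
  | l :: L, K => fun x => partialDeriv l (jetCoeff u J L K) x +
      ∑ α, if 0 < K α then
        jetCoeff u J L (K - Pi.single α 1) x * partialDeriv l (fun y => u y α) x else 0

/-- The Jacobian minor `J_B^A = det (∂ u_{α_r} / ∂ x_{λ_s})`, `A = (α_r)`, `B = (λ_s)`. -/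
def jacobianMinor {n q p : ℕ} (u : Cn n → Cn q) (A : Increasing p q) (B : Increasing p n)
    (x : Cn n) : ℂ :=
  (Matrix.of fun r s : Fin p => partialDeriv (B s) (fun y => u y (A r)) x).det

/-- The matrix `P_k(p)` at the point `m`, with entries `M_L^K(u_i, J_{i,B}^A)`, where
`|L| = |K| = k`. Its `b(n,p) c(n,k)` rows are indexed by `(B, L)` and its `d b(q,p) c(q,k)` columns
by `(i, A, K)`. -/
def P {d n q : ℕ} (u : Fin d → Cn n → Cn q) (m : Cn n) (p k : ℕ) :
    Matrix (Increasing p n × MultiIndex n k) (Fin d × Increasing p q × MultiIndex q k) ℂ :=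
  Matrix.of fun BL iAK =>
    jetCoeff (u iAK.1) (jacobianMinor (u iAK.1) iAK.2.1 BL.1) BL.2.toList iAK.2.2.1 m

/-- The web is `p`-ordinary: at every point of `U` all the matrices `P_k`, `k ≥ 0`, have maximal
rank. -/
def Web.IsOrdinary {d n q : ℕ} {U : Set (Cn n)} (W : Web d n q U) (p : ℕ) : Prop :=
  ∀ m ∈ U, ∀ u : Fin d → Cn n → Cn q, W.IsSystem u m → ∀ k : ℕ,
    (P u m p k).rank = min (b n p * c n k) (d * (b q p * c q k))

/-! ### The matrices `P̃_k` -/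

/-- The differential `S^{k+1} ⊗ ⋀^p → S^k ⊗ ⋀^{p+1}` of the Koszul complex of `ℂʳ`, where
`w (A, K)` stands for the value of the derivative `∂_K f_A` of the coefficients of a `p`-form
`∑_A f_A dy_A`. -/
def koszulD (r p k : ℕ) :
    (Increasing p r × MultiIndex r (k + 1) → ℂ) →ₗ[ℂ]
      (Increasing (p + 1) r × MultiIndex r k → ℂ) where
  toFun w CK := ∑ j : Fin (p + 1), (-1) ^ (j : ℕ) *
    w ((Fin.succAboveOrderEmb j).trans CK.1, CK.2.succ (CK.1 j))
  map_add' w w' := by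
    ext CK
    simp [mul_add, Finset.sum_add_distrib]
  map_smul' a w := by
    ext CK
    simp [Finset.mul_sum, mul_left_comm]

/-- The kernel of the Koszul differential on `S^k ⊗ ⋀^p`: the homogeneous parts of degree `k` of
the jets of closed `p`-forms on `ℂʳ`. For `k = 0` the differential is zero. -/
def koszulKer (r p : ℕ) : (k : ℕ) → Submodule ℂ (Increasing p r × MultiIndex r k → ℂ)
  | 0 => ⊤
  | k + 1 => LinearMap.ker (koszulD r p k)

/-- The space of the families `(w_i)_{1 ≤ i ≤ d}` with all `w_i` in the kernel of the Koszul
differential of `ℂ^q`. -/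
def closedColumns (d q p k : ℕ) :
    Submodule ℂ (Fin d × Increasing p q × MultiIndex q k → ℂ) :=
  ⨅ i : Fin d, (koszulKer q p k).comap
    (LinearMap.funLeft ℂ ℂ fun AK : Increasing p q × MultiIndex q k => (i, AK))

/-- The linear map with matrix `P̃_k(p)` at the point `m`: the restriction of `P_k(p)` to the
unknowns coming from closed forms (a space of dimension `d z(q,p,k)`); its image lies in the kernel
of the Koszul differential of `ℂⁿ` (of dimension `z(n,p,k)`). -/
def PTilde {d n q : ℕ} (u : Fin d → Cn n → Cn q) (m : Cn n) (p k : ℕ) :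
    closedColumns d q p k →ₗ[ℂ] (Increasing p n × MultiIndex n k → ℂ) :=
  (P u m p k).mulVecLin.domRestrict (closedColumns d q p k)

/-- The web is strongly `p`-ordinary: at every point of `U` all the `P̃_k`, `k ≥ 0`, have maximal
rank. -/
def Web.IsStronglyOrdinary {d n q : ℕ} {U : Set (Cn n)} (W : Web d n q U) (p : ℕ) : Prop :=
  ∀ m ∈ U, ∀ u : Fin d → Cn n → Cn q, W.IsSystem u m → ∀ k : ℕ,
    (Module.finrank ℂ (LinearMap.range (PTilde u m p k)) : ℤ) = min (z n p k) (d * z q p k)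

end AbelianWeb

end

/-! In suitable coordinates near `m` each foliation consists of the translates of a fixed linear
subspace. Its basic forms are the forms killed by that subspace and invariant under translation
along it. Both conditions are stable under dilations, so every homogeneous Taylor part of an abelian
relation is again an abelian relation. Let H_k be the space of homogeneous relations of degree k.
The sum of the H_k over k < N embeds into the germs at `m` (`germOfRelations_injective`), and it is
the whole space once H_k = 0 for all k ≥ N (`exists_germOfRelations_eq`). The chart is normalised to
have differential the identity at `m`, so H_k depends only on the tangent spaces of the web at `m`.

H_k is also the kernel of P_k. When |K| = |L|, every derivation in the definition of M_L^K must fall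
on f, so the entry involves only du_i(m). Hence P_k is the matrix, on k-jets, of the sum of the
pullbacks by the linear maps du_i(m) (`P_mulVec_formJet`, `map_pullbackOfJets`). Therefore dim H_k
is the number of columns minus the rank of P_k. It is at least (columns - rows)⁺, with equality
exactly when the rank is maximal. Summing over k gives π⁰ in the ordinary case. Otherwise one pair
(m, k) with strict inequality already pushes the rank above π⁰.

For closed relations the columns are restricted to the Koszul kernel, and the image lies in the
Koszul kernel of ℂⁿ. These kernels have dimension z(r,p,k) because the Koszul complex is exact
(`range_koszulD`, `finrank_koszulKer`), by the homotopy given by contraction with the Euler field.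
Both sums are finite by elementary binomial estimates (`exists_piZero_bound`,
`exists_piPrime_bound`). -/

noncomputable section

namespace AbelianWeb

/-! ### Holomorphic maps on finite-dimensional spaces are smooth. -/

section Smooth

open Metric

variable {E F : Type*} [NormedAddCommGroup E] [NormedSpace ℂ E]
  [NormedAddCommGroup F] [NormedSpace ℂ F]

theorem hasDerivAt_line {f : E → F} {x v : E} {z : ℂ} (h : DifferentiableAt ℂ f (x + z • v)) :
    HasDerivAt (fun z : ℂ => f (x + z • v)) (fderiv ℂ f (x + z • v) v) z := by
  have h1 : HasDerivAt (fun z : ℂ => x + z • v) v z := by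
    simpa using ((hasDerivAt_id z).smul_const v).const_add x
  exact h.hasFDerivAt.comp_hasDerivAt z h1

/-- Cauchy estimate for the differential of a bounded holomorphic function on a ball. -/
theorem norm_fderiv_le_of_bounded {f : E → F} {m x : E} {R M : ℝ} (hR : 0 < R)
    (hf : ∀ y ∈ ball m R, DifferentiableAt ℂ f y) (hM : ∀ y ∈ ball m R, ‖f y‖ ≤ M)
    (hx : x ∈ ball m (R / 2)) : ‖fderiv ℂ f x‖ ≤ 4 * M / R := by
  have hM0 : 0 ≤ M := (norm_nonneg _).trans (hM m (mem_ball_self hR))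
  refine ContinuousLinearMap.opNorm_le_bound _ (by positivity) fun v => ?_
  rcases eq_or_ne v 0 with rfl | hv
  · simp
  have hv' : 0 < ‖v‖ := norm_pos_iff.2 hv
  set ρ : ℝ := R / (4 * ‖v‖) with hρ
  have hρ0 : 0 < ρ := by positivity
  have hmem : ∀ z ∈ closedBall (0 : ℂ) ρ, x + z • v ∈ ball m R := by
    intro z hz
    have hz' : ‖z‖ ≤ ρ := by simpa using hz
    have h1 : ‖z • v‖ ≤ R / 4 := by
      rw [norm_smul]
      calc ‖z‖ * ‖v‖ ≤ ρ * ‖v‖ := by gcongr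
        _ = R / 4 := by rw [hρ]; field_simp
    rw [mem_ball, dist_eq_norm] at hx ⊢
    calc ‖x + z • v - m‖ = ‖(x - m) + z • v‖ := by congr 1; abel
      _ ≤ ‖x - m‖ + ‖z • v‖ := norm_add_le _ _
      _ < R := by linarith
  have hd : DifferentiableOn ℂ (fun z : ℂ => f (x + z • v)) (closedBall 0 ρ) := fun z hz =>
    (hasDerivAt_line (hf _ (hmem z hz))).differentiableAt.differentiableWithinAt
  have h2 := Complex.norm_deriv_le_of_forall_mem_sphere_norm_le hρ0
    (hd.mono closure_ball_subset_closedBall).diffContOnCl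
    (fun z hz => hM _ (hmem z (sphere_subset_closedBall hz)))
  rw [(hasDerivAt_line (hf _ (hmem 0 (mem_closedBall_self hρ0.le)))).deriv] at h2
  simp only [zero_smul, add_zero] at h2
  refine h2.trans (le_of_eq ?_)
  rw [hρ]; field_simp

/-- Cauchy's formula on the complex line through x in direction v writes the directional derivative
as an integral of values of f over a circle. One differentiates under the integral sign; the
Lipschitz bound needed for domination comes from the Cauchy estimate. -/
theorem differentiableAt_fderiv_apply [FiniteDimensional ℂ E] [FiniteDimensional ℂ F]
    {f : E → F} {m : E} (hf : ∀ᶠ x in 𝓝 m, DifferentiableAt ℂ f x) (v : E) :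
    DifferentiableAt ℂ (fun x => fderiv ℂ f x v) m := by
  have : CompleteSpace F := FiniteDimensional.complete ℂ F
  obtain ⟨R, hR, hfR, hM⟩ : ∃ R > 0, (∀ y ∈ ball m R, DifferentiableAt ℂ f y) ∧
      ∀ y ∈ ball m R, ‖f y‖ ≤ ‖f m‖ + 1 := by
    have h1 : ∀ᶠ y in 𝓝 m, ‖f y‖ < ‖f m‖ + 1 :=
      hf.self_of_nhds.continuousAt.norm.eventually_lt continuousAt_const (by linarith)
    obtain ⟨R, hR, h⟩ := Metric.eventually_nhds_iff_ball.1 (hf.and h1)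
    exact ⟨R, hR, fun y hy => (h y hy).1, fun y hy => (h y hy).2.le⟩
  set M := ‖f m‖ + 1
  have hM0 : 0 ≤ M := by positivity
  -- Circles of this radius around points of the ball of radius R/4 stay in the ball of radius R/2,
  -- where the Cauchy estimate applies. The `+ 1` covers v = 0.
  set ρ : ℝ := R / (4 * (‖v‖ + 1)) with hρ
  have hρ0 : 0 < ρ := by positivity
  have hmem : ∀ x ∈ ball m (R / 4), ∀ z ∈ closedBall (0 : ℂ) ρ, x + z • v ∈ ball m (R / 2) := by
    intro x hx z hz
    have hz' : ‖z‖ ≤ ρ := by simpa using hz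
    have h1 : ‖z • v‖ ≤ R / 4 := by
      rw [norm_smul]
      calc ‖z‖ * ‖v‖ ≤ ρ * (‖v‖ + 1) := by gcongr; linarith
        _ = R / 4 := by rw [hρ]; field_simp
    rw [mem_ball, dist_eq_norm] at hx ⊢
    calc ‖x + z • v - m‖ = ‖(x - m) + z • v‖ := by congr 1; abel
      _ ≤ ‖x - m‖ + ‖z • v‖ := norm_add_le _ _
      _ < R / 2 := by linarith
  have hsub : ball m (R / 2) ⊆ ball m R := ball_subset_ball (by linarith)
  have hcirc : ∀ θ : ℝ, circleMap 0 ρ θ ∈ closedBall (0 : ℂ) ρ := fun θ =>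
    circleMap_mem_closedBall 0 hρ0.le θ
  set k : ℝ → ℂ := fun θ => deriv (circleMap 0 ρ) θ * (1 / (circleMap 0 ρ θ - 0) ^ 2) with hk
  have hkc : Continuous k := by
    simp only [hk, deriv_circleMap]
    refine ((continuous_circleMap 0 ρ).mul continuous_const).mul
      (continuous_const.div (((continuous_circleMap 0 ρ).sub continuous_const).pow 2) fun θ => ?_)
    simp [hρ0.ne']
  have hk_norm : ∀ θ, ‖k θ‖ = 1 / ρ := by
    intro θ
    simp only [hk, deriv_circleMap, norm_mul, norm_div, norm_pow, sub_zero, norm_one,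
      Complex.norm_I, norm_circleMap_zero, abs_of_pos hρ0]
    field_simp
  have key : ∀ x ∈ ball m (R / 4), fderiv ℂ f x v =
      (2 * Real.pi * Complex.I : ℂ)⁻¹ •
        ∫ θ in Set.Ioc 0 (2 * Real.pi), k θ • f (x + circleMap 0 ρ θ • v) := by
    intro x hx
    have hd : DifferentiableOn ℂ (fun z : ℂ => f (x + z • v)) (closedBall 0 ρ) := fun z hz =>
      (hasDerivAt_line (hfR _ (hsub (hmem x hx z hz)))).differentiableAt.differentiableWithinAt
    have h2 := (hd.mono closure_ball_subset_closedBall).diffContOnCl.deriv_eq_smul_circleIntegral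
      hρ0
    rw [(hasDerivAt_line (hfR _ (hsub (hmem x hx 0 (mem_closedBall_self hρ0.le))))).deriv] at h2
    simp only [zero_smul, add_zero] at h2
    rw [circleIntegral, intervalIntegral.integral_of_le (by positivity)] at h2
    rw [eq_inv_smul_iff₀ (by simp [Real.pi_ne_zero]), ← h2]
    simp only [hk, mul_smul]
  have hcont : ∀ x ∈ ball m (R / 4), Continuous fun θ => k θ • f (x + circleMap 0 ρ θ • v) := by
    intro x hx
    refine hkc.smul (continuous_iff_continuousAt.2 fun θ => ?_)
    exact (hfR _ (hsub (hmem x hx _ (hcirc θ)))).continuousAt.comp (f := fun θ =>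
      x + circleMap 0 ρ θ • v) (by fun_prop)
  have hdiff : DifferentiableAt ℂ (fun x => ∫ θ in Set.Ioc 0 (2 * Real.pi),
      k θ • f (x + circleMap 0 ρ θ • v)) m := by
    let _ : MeasurableSpace E := borel E
    have : BorelSpace E := ⟨rfl⟩
    let _ : MeasurableSpace (E →L[ℂ] F) := borel _
    have : BorelSpace (E →L[ℂ] F) := ⟨rfl⟩
    have : ProperSpace (E →L[ℂ] F) := FiniteDimensional.proper ℂ _
    have hm : m ∈ ball m (R / 4) := mem_ball_self (by positivity)
    refine (hasFDerivAt_integral_of_dominated_loc_of_lip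
      (F' := fun θ => k θ • fderiv ℂ f (m + circleMap 0 ρ θ • v))
      (bound := fun _ => 1 / ρ * (4 * M / R)) (ball_mem_nhds m (by positivity : 0 < R / 4))
      ?_ ?_ ?_ ?_ ?_ ?_).2.differentiableAt
    · filter_upwards [ball_mem_nhds m (by positivity : 0 < R / 4)] with x hx
      exact (hcont x hx).aestronglyMeasurable
    · exact ((hcont m hm).integrableOn_Icc).mono_set Set.Ioc_subset_Icc_self
    · refine hkc.aestronglyMeasurable.smul (Measurable.aestronglyMeasurable ?_)
      exact (measurable_fderiv ℂ f).comp (by fun_prop : Continuous fun θ : ℝ =>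
        m + circleMap 0 ρ θ • v).measurable
    · refine Filter.Eventually.of_forall fun θ => ?_
      refine LipschitzOnWith.of_dist_le_mul fun x hx y hy => ?_
      rw [dist_eq_norm, dist_eq_norm, ← smul_sub, norm_smul, hk_norm]
      have := (convex_ball m (R / 2)).norm_image_sub_le_of_norm_fderiv_le (𝕜 := ℂ) (f := f)
        (fun y hy => hfR y (hsub hy)) (fun y hy => norm_fderiv_le_of_bounded hR hfR hM hy)
        (hmem y hy _ (hcirc θ)) (hmem x hx _ (hcirc θ))
      rw [Real.coe_nnabs, abs_of_nonneg (by positivity), mul_assoc]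
      gcongr
      simpa using this
    · exact MeasureTheory.integrable_const _
    · refine Filter.Eventually.of_forall fun θ => ?_
      have h1 : HasFDerivAt (fun x : E => x + circleMap 0 ρ θ • v) (ContinuousLinearMap.id ℂ E) m :=
        (hasFDerivAt_id m).add_const _
      have h2 := (hfR _ (hsub (hmem m hm _ (hcirc θ)))).hasFDerivAt.comp m h1
      rw [ContinuousLinearMap.comp_id] at h2
      exact h2.const_smul (k θ)
  refine (hdiff.const_smul ((2 * Real.pi * Complex.I : ℂ)⁻¹)).congr_of_eventuallyEq ?_
  filter_upwards [ball_mem_nhds m (by positivity : 0 < R / 4)] with x hx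
  exact key x hx

theorem differentiableAt_fderiv [FiniteDimensional ℂ E] [FiniteDimensional ℂ F]
    {f : E → F} {m : E} (hf : ∀ᶠ x in 𝓝 m, DifferentiableAt ℂ f x) :
    DifferentiableAt ℂ (fderiv ℂ f) m := by
  let b := Module.finBasis ℂ E
  let e : (E →L[ℂ] F) ≃L[ℂ] (Fin (Module.finrank ℂ E) → F) :=
    (LinearMap.toContinuousLinearMap.symm ≪≫ₗ (b.constr ℂ).symm).toContinuousLinearEquiv
  rw [← e.comp_differentiableAt_iff, differentiableAt_pi]
  exact fun i => differentiableAt_fderiv_apply hf (b i)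

theorem contDiffOn_nat_of_differentiableOn [FiniteDimensional ℂ E] {s : Set E} (hs : IsOpen s)
    (k : ℕ) [FiniteDimensional ℂ F] {f : E → F} (h : DifferentiableOn ℂ f s) :
    ContDiffOn ℂ k f s := by
  induction k generalizing f with
  | zero => exact contDiffOn_zero.2 h.continuousOn
  | succ k ih =>
    push_cast
    rw [contDiffOn_succ_iff_fderiv_of_isOpen hs]
    refine ⟨h, by simp, contDiffOn_clm_apply.2 fun v => ih fun x hx =>
      (differentiableAt_fderiv_apply ?_ v).differentiableWithinAt⟩
    filter_upwards [hs.mem_nhds hx] with y hy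
    exact h.differentiableAt (hs.mem_nhds hy)

/-- A function which is complex differentiable near a point of a finite-dimensional space is
smooth. -/
theorem contDiffAt_of_eventually_differentiableAt [FiniteDimensional ℂ E] [FiniteDimensional ℂ F]
    {f : E → F} {m : E} (hf : ∀ᶠ x in 𝓝 m, DifferentiableAt ℂ f x) (k : ℕ) :
    ContDiffAt ℂ k f m := by
  obtain ⟨s, hs, ho, hm⟩ := _root_.eventually_nhds_iff.1 hf
  exact (contDiffOn_nat_of_differentiableOn ho k
    fun x hx => (hs x hx).differentiableWithinAt).contDiffAt (ho.mem_nhds hm)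

theorem contDiff_of_differentiable [FiniteDimensional ℂ E] [FiniteDimensional ℂ F]
    {f : E → F} (hf : Differentiable ℂ f) (k : ℕ) : ContDiff ℂ k f :=
  contDiff_iff_contDiffAt.2 fun _ =>
    contDiffAt_of_eventually_differentiableAt (.of_forall hf) k

end Smooth

/-! ### Iterated partial derivatives, homogeneous maps and Taylor expansions. -/

section Jets

variable {r : ℕ} {V : Type*} [NormedAddCommGroup V] [NormedSpace ℂ V]

/-- The partial derivative of a vector-valued function. -/
def coordDeriv (l : Fin r) (f : Cn r → V) (x : Cn r) : V := fderiv ℂ f x (Pi.single l 1)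

/-- The iterated partial derivative along a list of variables. -/
def iterDeriv : List (Fin r) → (Cn r → V) → Cn r → V
  | [], f => f
  | l :: L, f => coordDeriv l (iterDeriv L f)

theorem iterDeriv_append (L L' : List (Fin r)) (f : Cn r → V) :
    iterDeriv (L ++ L') f = iterDeriv L (iterDeriv L' f) := by
  induction L with
  | nil => rfl
  | cons l L ih => simp only [List.cons_append, iterDeriv, ih]

theorem fderiv_eq_sum_coordDeriv (f : Cn r → V) (x v : Cn r) :
    fderiv ℂ f x v = ∑ l, v l • coordDeriv l f x := by
  conv_lhs => rw [← Finset.univ_sum_single v, map_sum]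
  refine Finset.sum_congr rfl fun l _ => ?_
  rw [coordDeriv, ← map_smul, ← Pi.single_smul, smul_eq_mul, mul_one]

section

variable [FiniteDimensional ℂ V]

theorem eventually_differentiableAt_coordDeriv {f : Cn r → V} {m : Cn r}
    (hf : ∀ᶠ x in 𝓝 m, DifferentiableAt ℂ f x) (l : Fin r) :
    ∀ᶠ x in 𝓝 m, DifferentiableAt ℂ (coordDeriv l f) x := by
  filter_upwards [hf.eventually_nhds] with x hx
  exact differentiableAt_fderiv_apply hx _

theorem eventually_differentiableAt_iterDeriv {f : Cn r → V} {m : Cn r}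
    (hf : ∀ᶠ x in 𝓝 m, DifferentiableAt ℂ f x) (L : List (Fin r)) :
    ∀ᶠ x in 𝓝 m, DifferentiableAt ℂ (iterDeriv L f) x := by
  induction L with
  | nil => exact hf
  | cons l L ih => exact eventually_differentiableAt_coordDeriv ih l

theorem differentiable_coordDeriv {f : Cn r → V} (hf : Differentiable ℂ f) (l : Fin r) :
    Differentiable ℂ (coordDeriv l f) := fun _ =>
  differentiableAt_fderiv_apply (.of_forall hf) _

theorem differentiable_iterDeriv {f : Cn r → V} (hf : Differentiable ℂ f) (L : List (Fin r)) :
    Differentiable ℂ (iterDeriv L f) := by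
  induction L with
  | nil => exact hf
  | cons l L ih => exact differentiable_coordDeriv ih l

theorem coordDeriv_comm {f : Cn r → V} {m : Cn r}
    (hf : ∀ᶠ x in 𝓝 m, DifferentiableAt ℂ f x) (i j : Fin r) :
    coordDeriv i (coordDeriv j f) m = coordDeriv j (coordDeriv i f) m := by
  have hd := differentiableAt_fderiv hf
  have key : ∀ i j : Fin r, coordDeriv i (coordDeriv j f) m =
      fderiv ℂ (fderiv ℂ f) m (Pi.single i 1) (Pi.single j 1) := by
    intro i j
    have h := hd.hasFDerivAt.clm_apply (hasFDerivAt_const (Pi.single j (1 : ℂ)) m)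
    simp [coordDeriv, h.fderiv, show coordDeriv j f = fun x => fderiv ℂ f x (Pi.single j 1) from rfl]
  rw [key, key]
  exact (contDiffAt_of_eventually_differentiableAt hf 2).isSymmSndFDerivAt (by simp) _ _

/-- Lists suit the recursion defining `jetCoeff`; this makes the derivative depend on the
multi-index alone. Equality of germs, not just of values at m, lets the induction differentiate once
more. -/
theorem iterDeriv_perm {f : Cn r → V} {m : Cn r}
    (hf : ∀ᶠ x in 𝓝 m, DifferentiableAt ℂ f x) {L L' : List (Fin r)} (h : L.Perm L') :
    iterDeriv L f =ᶠ[𝓝 m] iterDeriv L' f := by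
  induction h with
  | nil => rfl
  | cons l _ ih =>
    filter_upwards [ih.fderiv (𝕜 := ℂ)] with x hx
    simp only [iterDeriv, coordDeriv, hx]
  | swap i j L =>
    filter_upwards [(eventually_differentiableAt_iterDeriv hf L).eventually_nhds] with x hx
    exact coordDeriv_comm hx j i
  | trans _ _ h1 h2 => exact h1.trans h2

end

/-- Holomorphic maps `Cn r → V` which are homogeneous of degree `k`. -/
def homMaps (r k : ℕ) (V : Type*) [NormedAddCommGroup V] [NormedSpace ℂ V] :
    Submodule ℂ (Cn r → V) where
  carrier := {f | Differentiable ℂ f ∧ ∀ (t : ℂ) (x : Cn r), f (t • x) = t ^ k • f x}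
  zero_mem' := ⟨differentiable_const _, by simp⟩
  add_mem' := fun hf hg => ⟨hf.1.add hg.1, fun t x => by simp [hf.2, hg.2]⟩
  smul_mem' := fun a f hf => ⟨hf.1.const_smul a, fun t x => by
    simp [hf.2, smul_comm a (t ^ k)]⟩

theorem apply_eq_of_mem_homMaps_zero {f : Cn r → V} (hf : f ∈ homMaps r 0 V) (x : Cn r) :
    f x = f 0 := by
  simpa using (hf.2 0 x).symm

theorem apply_zero_of_mem_homMaps_succ {k : ℕ} {f : Cn r → V} (hf : f ∈ homMaps r (k + 1) V) :
    f 0 = 0 := by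
  simpa using hf.2 0 0

theorem fderiv_of_mem_homMaps_zero {f : Cn r → V} (hf : f ∈ homMaps r 0 V) (x : Cn r) :
    fderiv ℂ f x = 0 := by
  rw [show f = fun _ => f 0 from funext (apply_eq_of_mem_homMaps_zero hf)]
  simp

/-- Euler's identity. -/
theorem fderiv_self_of_mem_homMaps {k : ℕ} {f : Cn r → V} (hf : f ∈ homMaps r k V) (x : Cn r) :
    fderiv ℂ f x x = (k : ℂ) • f x := by
  have h1 := hasDerivAt_line (x := 0) (v := x) (z := 1) (hf.1.differentiableAt)
  have h2 : HasDerivAt (fun t : ℂ => t ^ k • f x) ((k : ℂ) • f x) 1 := by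
    simpa using (hasDerivAt_pow k (1 : ℂ)).smul_const (f x)
  simp only [zero_add, hf.2] at h1
  simpa using h1.unique h2

/-- Differentiate f(tx) = t^(k+1) f(x) in x and cancel t. At t = 0 cancellation fails: for k = 0 the
map f is linear, and for k > 0 its differential at 0 vanishes. -/
theorem fderiv_smul_of_mem_homMaps {k : ℕ} {f : Cn r → V} (hf : f ∈ homMaps r (k + 1) V) (t : ℂ)
    (x : Cn r) : fderiv ℂ f (t • x) = t ^ k • fderiv ℂ f x := by
  by_cases ht : t = 0
  · subst ht
    rcases k.eq_zero_or_pos with rfl | hk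
    · have h5 : ∀ w, f w = fderiv ℂ f 0 w := by
        intro w
        have h6 := (hasDerivAt_line (x := 0) (v := w) (z := 0) hf.1.differentiableAt)
        simp only [zero_add, hf.2, pow_one, zero_smul] at h6
        have h7 : HasDerivAt (fun t : ℂ => t • f w) (f w) 0 := by
          simpa using (hasDerivAt_id (0 : ℂ)).smul_const (f w)
        exact h7.unique h6
      rw [show f = fderiv ℂ f 0 from funext h5]
      simp
    · rw [zero_pow hk.ne', zero_smul, zero_smul]
      ext v
      have h6 := (hasDerivAt_line (x := 0) (v := v) (z := 0) hf.1.differentiableAt)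
      simp only [zero_add, hf.2, zero_smul] at h6
      have h7 : HasDerivAt (fun t : ℂ => t ^ (k + 1) • f v) 0 0 := by
        simpa [hk.ne'] using (hasDerivAt_pow (k + 1) (0 : ℂ)).smul_const (f v)
      simpa using h6.unique h7
  · have h3 := fderiv_comp_smul (𝕜 := ℂ) (f := f) (x := x) t
    simp only [hf.2] at h3
    rw [fderiv_fun_const_smul hf.1.differentiableAt, pow_succ', mul_smul] at h3
    exact (smul_right_injective _ ht h3).symm

theorem coordDeriv_mem_homMaps [FiniteDimensional ℂ V] {k : ℕ} {f : Cn r → V}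
    (hf : f ∈ homMaps r (k + 1) V) (l : Fin r) : coordDeriv l f ∈ homMaps r k V :=
  ⟨differentiable_coordDeriv hf.1 l, fun t x => by
    simp [coordDeriv, fderiv_smul_of_mem_homMaps hf]⟩

/-- A homogeneous map is determined by its derivatives at the origin. -/
theorem eq_zero_of_mem_homMaps [FiniteDimensional ℂ V] {k : ℕ} {f : Cn r → V}
    (hf : f ∈ homMaps r k V)
    (h : ∀ L : List (Fin r), L.length = k → iterDeriv L f 0 = 0) : f = 0 := by
  induction k generalizing f with
  | zero => exact funext fun x => (apply_eq_of_mem_homMaps_zero hf x).trans (h [] rfl)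
  | succ k ih =>
    have h1 : ∀ l, coordDeriv l f = 0 := fun l => by
      refine ih (coordDeriv_mem_homMaps hf l) fun L hL => ?_
      have := h (L ++ [l]) (by simp [hL])
      rwa [iterDeriv_append] at this
    have h2 : ∀ x, fderiv ℂ f x = 0 := fun x => by
      ext v
      rw [fderiv_eq_sum_coordDeriv]
      simp [h1]
    funext x
    rw [is_const_of_fderiv_eq_zero hf.1 h2 x 0, apply_zero_of_mem_homMaps_succ hf]
    rfl

/-- The homogeneous polynomial map of degree `k` with prescribed derivatives at the origin. -/
def polyOfJet : ℕ → (List (Fin r) → V) → Cn r → V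
  | 0, w => fun _ => w []
  | k + 1, w => fun x => ((k : ℂ) + 1)⁻¹ • ∑ l, x l • polyOfJet k (fun L => w (l :: L)) x

theorem polyOfJet_mem_homMaps (k : ℕ) (w : List (Fin r) → V) :
    polyOfJet k w ∈ homMaps r k V := by
  induction k generalizing w with
  | zero => exact ⟨differentiable_const _, by simp [polyOfJet]⟩
  | succ k ih =>
    refine ⟨?_, fun t x => ?_⟩
    · refine Differentiable.const_smul (Differentiable.fun_sum fun l _ => ?_) _
      exact Differentiable.smul (by fun_prop) (ih _).1
    · simp only [polyOfJet, (ih _).2, Pi.smul_apply, smul_eq_mul, Finset.smul_sum, smul_smul]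
      refine Finset.sum_congr rfl fun l _ => ?_
      congr 1
      ring

/-- `polyOfJet` integrates the prescribed partial derivatives g_l by Euler's formula. Permutation
invariance of w is the integrability condition ∂_j g_l = ∂_l g_j. Given it, differentiating ∑ x_l
g_l produces g_j plus the Euler derivative of g_j, a multiple of g_j that the normalising factor
cancels. -/
theorem coordDeriv_polyOfJet (k : ℕ) {w : List (Fin r) → V}
    (hw : ∀ L L' : List (Fin r), L.Perm L' → w L = w L') (j : Fin r) :
    coordDeriv j (polyOfJet (k + 1) w) = polyOfJet k (fun L => w (j :: L)) := by
  induction k generalizing w j with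
  | zero =>
    funext x
    have : HasFDerivAt (polyOfJet 1 w)
        (∑ l, (ContinuousLinearMap.proj (R := ℂ) (φ := fun _ => ℂ) l).smulRight (w [l])) x := by
      have h : polyOfJet 1 w =
          (∑ l, (ContinuousLinearMap.proj (R := ℂ) (φ := fun _ => ℂ) l).smulRight (w [l]) :
            Cn r →L[ℂ] V) := by
        funext y; simp [polyOfJet]
      rw [h]
      exact ContinuousLinearMap.hasFDerivAt _
    rw [coordDeriv, this.fderiv]
    simp [polyOfJet, Pi.single_apply, ite_smul]
  | succ k ih =>
    funext x
    set g : Fin r → Cn r → V := fun l => polyOfJet (k + 1) (fun L => w (l :: L)) with hg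
    have hgm : ∀ l, g l ∈ homMaps r (k + 1) V := fun l => polyOfJet_mem_homMaps _ _
    have h1 : HasFDerivAt (polyOfJet (k + 2) w)
        (((k + 1 : ℕ) + 1 : ℂ)⁻¹ • ∑ l, (x l • fderiv ℂ (g l) x +
          (ContinuousLinearMap.proj (R := ℂ) (φ := fun _ => ℂ) l).smulRight (g l x))) x := by
      refine HasFDerivAt.const_smul (HasFDerivAt.fun_sum fun l _ => ?_) _
      exact (ContinuousLinearMap.proj (R := ℂ) (φ := fun _ => ℂ) l).hasFDerivAt.smul
        (hgm l).1.differentiableAt.hasFDerivAt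
    have h2 : ∀ l, coordDeriv j (g l) = coordDeriv l (g j) := by
      intro l
      rw [hg, ih (fun L L' h => hw _ _ (h.cons l)), ih (fun L L' h => hw _ _ (h.cons j))]
      congr 1
      exact funext fun L => hw _ _ (List.Perm.swap ..)
    have h3 := fderiv_self_of_mem_homMaps (hgm j) x
    rw [fderiv_eq_sum_coordDeriv] at h3
    rw [coordDeriv, h1.fderiv]
    simp only [smul_apply, sum_apply, add_apply, ContinuousLinearMap.smulRight_apply,
      ContinuousLinearMap.proj_apply, Finset.sum_add_distrib]
    have h4 : ∑ l, x l • fderiv ℂ (g l) x (Pi.single j 1) = ((k + 1 : ℕ) : ℂ) • g j x := by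
      rw [← h3]
      exact Finset.sum_congr rfl fun l _ => by rw [← h2 l]; rfl
    rw [h4]
    simp only [Pi.single_apply, ite_smul, one_smul, zero_smul, Finset.sum_ite_eq',
      Finset.mem_univ, if_true]
    have h5 : ((k + 1 : ℕ) : ℂ) + 1 ≠ 0 := Nat.cast_add_one_ne_zero (k + 1)
    rw [show ((k + 1 : ℕ) : ℂ) • g j x + g j x = (((k + 1 : ℕ) : ℂ) + 1) • g j x by
      rw [add_smul, one_smul], smul_smul, inv_mul_cancel₀ h5, one_smul]

theorem iterDeriv_polyOfJet {k : ℕ} {w : List (Fin r) → V}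
    (hw : ∀ L L' : List (Fin r), L.Perm L' → w L = w L') {L : List (Fin r)} (hL : L.length = k) :
    iterDeriv L (polyOfJet k w) 0 = w L := by
  induction k generalizing L w with
  | zero =>
    rw [List.length_eq_zero_iff] at hL
    subst hL
    rfl
  | succ k ih =>
    -- The last variable of the list is the first derivation applied to f.
    obtain ⟨L, j, rfl⟩ : ∃ L' j, L = L' ++ [j] :=
      ⟨L.dropLast, L.getLast (List.ne_nil_of_length_eq_add_one hL),
        (List.dropLast_append_getLast _).symm⟩
    rw [iterDeriv_append]
    change iterDeriv L (coordDeriv j (polyOfJet (k + 1) w)) 0 = _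
    rw [coordDeriv_polyOfJet k hw, ih (fun L L' h => hw _ _ (h.cons j)) (by simpa using hL)]
    exact hw _ _ (by simpa using (List.perm_append_comm (l₁ := [j]) (l₂ := L)))

/-- The homogeneous part of degree `k` of the Taylor expansion at the origin. -/
def taylorPart (k : ℕ) (f : Cn r → V) : Cn r → V := polyOfJet k fun L => iterDeriv L f 0

theorem taylorPart_mem_homMaps (k : ℕ) (f : Cn r → V) : taylorPart k f ∈ homMaps r k V :=
  polyOfJet_mem_homMaps _ _

theorem eventually_differentiableAt_line {f : Cn r → V}
    (hf : ∀ᶠ x in 𝓝 0, DifferentiableAt ℂ f x) (x : Cn r) :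
    ∀ᶠ z : ℂ in 𝓝 0, DifferentiableAt ℂ f (z • x) :=
  (show Filter.Tendsto (fun z : ℂ => z • x) (𝓝 0) (𝓝 0) by
    have h : Continuous fun z : ℂ => z • x := by fun_prop
    simpa using h.tendsto 0).eventually hf

variable [FiniteDimensional ℂ V]

theorem coordDeriv_taylorPart (k : ℕ) {f : Cn r → V}
    (hf : ∀ᶠ x in 𝓝 0, DifferentiableAt ℂ f x) (j : Fin r) :
    coordDeriv j (taylorPart (k + 1) f) = taylorPart k (coordDeriv j f) := by
  rw [taylorPart, coordDeriv_polyOfJet k fun L L' h => (iterDeriv_perm hf h).self_of_nhds]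
  congr 1
  funext L
  have h : (j :: L).Perm (L ++ [j]) := by
    simpa using (List.perm_append_comm (l₁ := [j]) (l₂ := L))
  rw [(iterDeriv_perm hf h).self_of_nhds, iterDeriv_append]
  rfl

/-- This reduces Taylor expansions in several variables to one-variable expansions along lines
through the origin. -/
theorem iteratedDeriv_line (k : ℕ) {f : Cn r → V}
    (hf : ∀ᶠ x in 𝓝 0, DifferentiableAt ℂ f x) (x : Cn r) :
    iteratedDeriv k (fun z : ℂ => f (z • x)) 0 = (k.factorial : ℂ) • taylorPart k f x := by
  induction k generalizing f with
  | zero => simp [taylorPart, polyOfJet, iterDeriv]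
  | succ k ih =>
    have h1 : deriv (fun z : ℂ => f (z • x)) =ᶠ[𝓝 0]
        fun z => ∑ l, x l • coordDeriv l f (z • x) := by
      filter_upwards [eventually_differentiableAt_line hf x] with z hz
      have := hasDerivAt_line (x := 0) (v := x) (z := z) (by simpa using hz)
      simp only [zero_add] at this
      rw [this.deriv, fderiv_eq_sum_coordDeriv]
    have h2 : ∀ l, ContDiffAt ℂ k (fun z : ℂ => coordDeriv l f (z • x)) 0 := fun l => by
      refine contDiffAt_of_eventually_differentiableAt ?_ k
      filter_upwards [eventually_differentiableAt_line
        (eventually_differentiableAt_coordDeriv hf l) x] with z hz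
      exact hz.comp z (differentiableAt_id.smul_const x)
    rw [iteratedDeriv_succ', h1.iteratedDeriv_eq, iteratedDeriv_fun_sum
      (fun l _ => (h2 l).const_smul (x l)), taylorPart, polyOfJet, smul_smul, Finset.smul_sum]
    refine Finset.sum_congr rfl fun l _ => ?_
    rw [iteratedDeriv_fun_const_smul (h2 l) (x l), ih (eventually_differentiableAt_coordDeriv hf l),
      smul_smul, smul_smul]
    have h3 : (polyOfJet k fun L => iterDeriv (l :: L) f 0) = taylorPart k (coordDeriv l f) := by
      rw [← coordDeriv_taylorPart k hf, taylorPart,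
        coordDeriv_polyOfJet k fun L L' h => (iterDeriv_perm hf h).self_of_nhds]
    rw [h3]
    congr 1
    have : (k : ℂ) + 1 ≠ 0 := Nat.cast_add_one_ne_zero k
    push_cast [Nat.factorial_succ]
    field_simp

/-- For small x the function z ↦ f(zx) is holomorphic on the disc of radius 2; its Taylor series is
evaluated at z = 1. -/
theorem eventually_hasSum_taylorPart {f : Cn r → V}
    (hf : ∀ᶠ x in 𝓝 0, DifferentiableAt ℂ f x) :
    ∀ᶠ x in 𝓝 0, HasSum (fun k => taylorPart k f x) (f x) := by
  have : CompleteSpace V := FiniteDimensional.complete ℂ V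
  obtain ⟨R, hR, h⟩ := Metric.eventually_nhds_iff_ball.1 hf
  filter_upwards [Metric.ball_mem_nhds (0 : Cn r) (by positivity : 0 < R / 2)] with x hx
  have hd : DifferentiableOn ℂ (fun z : ℂ => f (z • x)) (Metric.ball 0 2) := by
    intro z hz
    have hz' : ‖z‖ < 2 := by simpa using hz
    have hx' : ‖x‖ < R / 2 := by simpa using hx
    have h1 : z • x ∈ Metric.ball 0 R := by
      rw [mem_ball_zero_iff, norm_smul]
      nlinarith [norm_nonneg x, norm_nonneg z]
    exact ((h _ h1).comp z (differentiableAt_id.smul_const x)).differentiableWithinAt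
  have h2 := Complex.hasSum_taylorSeries_on_ball hd (z := 1) (by simp)
  simp only [one_smul, sub_zero, one_pow, iteratedDeriv_line _ hf, smul_smul] at h2
  convert! h2 using 2 with k
  rw [one_mul, inv_mul_cancel₀ (by exact_mod_cast k.factorial_ne_zero), one_smul]

end Jets

/-- Alternating `p`-linear forms on `ℂʳ`. -/
abbrev AltForm (r p : ℕ) : Type := Cn r [⋀^Fin p]→L[ℂ] ℂ

/-! ### Coordinates of alternating forms -/

section AltForm

variable {r p : ℕ}

/-- The vectors `(e_{α₁}, …, e_{α_p})` of the standard basis. -/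
def coordVec (A : Increasing p r) : Fin p → Cn r := fun j => Pi.single (A j) 1

/-- An injective family of basis vectors becomes increasing after sorting, which changes the value
only by a sign. -/
theorem altForm_ext {η θ : AltForm r p} (h : ∀ A : Increasing p r,
    η (coordVec A) = θ (coordVec A)) : η = θ := by
  apply ContinuousAlternatingMap.toAlternatingMap_injective
  refine Module.Basis.ext_alternating (Pi.basisFun ℂ (Fin r)) fun v hv => ?_
  have hmono : StrictMono (v ∘ Tuple.sort v) :=
    (Tuple.monotone_sort v).strictMono_of_injective (hv.comp (Tuple.sort v).injective)
  have h1 := h (OrderEmbedding.ofStrictMono _ hmono)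
  have h2 : coordVec (OrderEmbedding.ofStrictMono _ hmono) =
      (fun i => Pi.basisFun ℂ (Fin r) (v i)) ∘ Tuple.sort v := by
    funext j; simp [coordVec]
  rw [h2] at h1
  have h3 := (η.toAlternatingMap).map_perm (fun i => Pi.basisFun ℂ (Fin r) (v i)) (Tuple.sort v)
  have h4 := (θ.toAlternatingMap).map_perm (fun i => Pi.basisFun ℂ (Fin r) (v i)) (Tuple.sort v)
  have h5 : (Equiv.Perm.sign (Tuple.sort v)) • η.toAlternatingMap
      (fun i => Pi.basisFun ℂ (Fin r) (v i)) = (Equiv.Perm.sign (Tuple.sort v)) •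
      θ.toAlternatingMap (fun i => Pi.basisFun ℂ (Fin r) (v i)) := by
    rw [← h3, ← h4]; exact h1
  exact (MulAction.injective (Equiv.Perm.sign (Tuple.sort v))) h5

instance : FiniteDimensional ℂ (AltForm r p) := by
  let e : AltForm r p →ₗ[ℂ] (Increasing p r → ℂ) :=
    { toFun := fun η A => η (coordVec A)
      map_add' := fun _ _ => rfl
      map_smul' := fun _ _ => rfl }
  exact Module.Finite.of_injective e fun η θ h => altForm_ext fun A => congrFun h A

/-- The form `dx_{α₁} ∧ ⋯ ∧ dx_{α_p}`. -/
def basisForm (A : Increasing p r) : AltForm r p where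
  toAlternatingMap := Matrix.detRowAlternating.compLinearMap (LinearMap.funLeft ℂ ℂ A)
  cont := by
    change Continuous fun v : Fin p → Cn r => Matrix.det (Matrix.of fun s t => v s (A t))
    exact Continuous.matrix_det (by fun_prop)

theorem basisForm_apply (A : Increasing p r) (v : Fin p → Cn r) :
    basisForm A v = Matrix.det (Matrix.of fun s t => v s (A t)) := rfl

theorem basisForm_coordVec (A B : Increasing p r) :
    basisForm A (coordVec B) = if A = B then 1 else 0 := by
  rw [basisForm_apply]
  split_ifs with h
  · subst h
    rw [← Matrix.det_one (n := Fin p) (R := ℂ)]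
    congr 1
    ext s t
    simp [coordVec, Pi.single_apply, Matrix.one_apply, eq_comm]
  -- Otherwise the range of B lies in that of A, hence equals it by counting, and an increasing
  -- sequence is determined by its range. The index s then gives a zero row.
  · obtain ⟨s, hs⟩ : ∃ s, ∀ t, A t ≠ B s := by
      by_contra! hc
      apply h
      have h1 : Set.range B ⊆ Set.range A := by
        rintro _ ⟨s, rfl⟩; exact hc s
      have h2 : Set.range B = Set.range A := by
        refine Set.eq_of_subset_of_ncard_le h1 ?_ (Set.finite_range _)
        rw [← Set.image_univ, ← Set.image_univ, Set.ncard_image_of_injective _ A.injective,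
          Set.ncard_image_of_injective _ B.injective]
      exact DFunLike.coe_injective ((A.strictMono.range_inj B.strictMono).1 h2.symm)
    refine Matrix.det_eq_zero_of_row_eq_zero s fun t => ?_
    simp [coordVec, Pi.single_apply, hs t]

theorem sum_smul_basisForm_apply (a : Increasing p r → ℂ) (B : Increasing p r) :
    (∑ A, a A • basisForm A) (coordVec B) = a B := by
  simp [ContinuousAlternatingMap.sum_apply, basisForm_coordVec]

theorem altForm_apply_eq_sum (η : AltForm r p) (v : Fin p → Cn r) :
    η v = ∑ A, η (coordVec A) * Matrix.det (Matrix.of fun s t => v s (A t)) := by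
  have h : η = ∑ A, η (coordVec A) • basisForm A :=
    altForm_ext fun B => (sum_smul_basisForm_apply (fun A => η (coordVec A)) B).symm
  conv_lhs => rw [h]
  simp [ContinuousAlternatingMap.sum_apply, basisForm_apply]

/-- Evaluation of alternating forms. -/
def evalForm (v : Fin p → Cn r) : AltForm r p →L[ℂ] ℂ :=
  LinearMap.toContinuousLinearMap
    { toFun := fun η => η v
      map_add' := fun _ _ => rfl
      map_smul' := fun _ _ => rfl }

@[simp] theorem evalForm_apply (v : Fin p → Cn r) (η : AltForm r p) : evalForm v η = η v := rfl

end AltForm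

/-! ### Multi-indices -/

section MultiIndex

variable {r k : ℕ}

theorem MultiIndex.count_toList (K : MultiIndex r k) (j : Fin r) : K.toList.count j = K.1 j := by
  simp only [MultiIndex.toList, List.count_flatMap, Function.comp_def, List.count_replicate]
  simpa using (Fin.sum_univ_def (fun i => if i = j then K.1 i else 0)).symm

theorem MultiIndex.length_toList (K : MultiIndex r k) : K.toList.length = k := by
  have h : K.toList.length = ∑ j, K.1 j := by
    simp [MultiIndex.toList, List.length_flatMap, Fin.sum_univ_def]
  rw [h, K.2]

/-- The multi-index of a list of variables. -/
def MultiIndex.ofList (L : List (Fin r)) (hL : L.length = k) : MultiIndex r k :=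
  ⟨fun j => L.count j, by
    have := Multiset.sum_count_eq_card (s := Finset.univ) (m := (L : Multiset (Fin r))) (by simp)
    simpa [hL] using this⟩

theorem MultiIndex.toList_ofList (L : List (Fin r)) (hL : L.length = k) :
    (MultiIndex.ofList L hL).toList.Perm L := by
  rw [List.perm_iff_count]
  intro j
  rw [MultiIndex.count_toList]
  rfl

theorem MultiIndex.eq_of_perm {K K' : MultiIndex r k} (h : K.toList.Perm K'.toList) : K = K' := by
  apply Subtype.ext
  funext j
  rw [← count_toList, ← count_toList, h.count_eq]

theorem MultiIndex.toList_succ (K : MultiIndex r k) (α : Fin r) :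
    (K.succ α).toList.Perm (K.toList ++ [α]) := by
  rw [List.perm_iff_count]
  intro j
  rw [count_toList, List.count_append, count_toList]
  by_cases h : j = α
  · subst h; simp [MultiIndex.succ]
  · simp [MultiIndex.succ, h, Ne.symm h]

/-- Multi-indices of degree k are multisets of k variables, counted by stars and bars. -/
theorem card_multiIndex (r k : ℕ) : Fintype.card (MultiIndex r k) = c r k := by
  have h := Sym.card_sym_eq_choose (α := Fin r) k
  rw [Fintype.card_fin] at h
  rw [c, b, ← h]
  refine Fintype.card_congr (Equiv.ofBijective (fun K => ⟨K.toList, ?_⟩) ⟨?_, ?_⟩)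
  · simpa using K.length_toList
  · intro K K' hK
    exact MultiIndex.eq_of_perm (Multiset.coe_eq_coe.1 (congrArg Subtype.val hK))
  · rintro ⟨s, hs⟩
    induction s using Quotient.inductionOn with
    | h L => exact ⟨MultiIndex.ofList L hs,
        Subtype.ext (Multiset.coe_eq_coe.2 (MultiIndex.toList_ofList L hs))⟩

theorem card_increasing (p r : ℕ) : Fintype.card (Increasing p r) = b r p := by
  have h := Fintype.card_finset_len (α := Fin r) p
  rw [Fintype.card_fin] at h
  rw [b, ← h]
  refine (Fintype.card_congr (Equiv.ofBijective
    (fun s => (s.1.orderEmbOfFin s.2 : Increasing p r)) ⟨?_, ?_⟩)).symm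
  · intro s t hst
    apply Subtype.ext
    apply Finset.coe_injective
    rw [← Finset.range_orderEmbOfFin s.1 s.2, ← Finset.range_orderEmbOfFin t.1 t.2]
    exact congrArg (fun e : Increasing p r => Set.range e) hst
  · intro e
    refine ⟨⟨Finset.univ.map e.toEmbedding, by simp⟩, ?_⟩
    refine (DFunLike.coe_injective (Finset.orderEmbOfFin_unique _ (fun x => ?_) e.strictMono)).symm
    simp

end MultiIndex

/-! ### Derivatives and Taylor parts under germ equality and continuous linear maps. -/

section IterDeriv

variable {r : ℕ} {V V' : Type*} [NormedAddCommGroup V] [NormedSpace ℂ V]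
  [NormedAddCommGroup V'] [NormedSpace ℂ V']

theorem iterDeriv_congr {f g : Cn r → V} {m : Cn r} (h : f =ᶠ[𝓝 m] g) (L : List (Fin r)) :
    iterDeriv L f =ᶠ[𝓝 m] iterDeriv L g := by
  induction L with
  | nil => exact h
  | cons l L ih =>
    filter_upwards [ih.fderiv (𝕜 := ℂ)] with x hx
    simp only [iterDeriv, coordDeriv, hx]

theorem taylorPart_congr {f g : Cn r → V} (h : f =ᶠ[𝓝 0] g) (k : ℕ) :
    taylorPart k f = taylorPart k g := by
  rw [taylorPart, taylorPart]
  congr 1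
  exact funext fun L => (iterDeriv_congr h L).self_of_nhds

theorem polyOfJet_sum_clm {ι : Type*} (s : Finset ι) (A : ι → V →L[ℂ] V') (k : ℕ)
    (w : ι → List (Fin r) → V) (x : Cn r) :
    polyOfJet k (fun L => ∑ i ∈ s, A i (w i L)) x = ∑ i ∈ s, A i (polyOfJet k (w i) x) := by
  induction k generalizing w with
  | zero => rfl
  | succ k ih =>
    simp only [polyOfJet, ih fun i L => w i (_ :: L), map_smul, map_sum, Finset.smul_sum]
    exact Finset.sum_comm

variable [FiniteDimensional ℂ V]

theorem iterDeriv_sum_clm {ι : Type*} (s : Finset ι) (A : ι → V →L[ℂ] V') {f : ι → Cn r → V}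
    {m : Cn r} (hf : ∀ i ∈ s, ∀ᶠ x in 𝓝 m, DifferentiableAt ℂ (f i) x) (L : List (Fin r)) :
    iterDeriv L (fun x => ∑ i ∈ s, A i (f i x)) =ᶠ[𝓝 m]
      fun x => ∑ i ∈ s, A i (iterDeriv L (f i) x) := by
  induction L with
  | nil => rfl
  | cons l L ih =>
    have h : ∀ᶠ x in 𝓝 m, ∀ i ∈ s, DifferentiableAt ℂ (iterDeriv L (f i)) x :=
      (Filter.eventually_all_finset s).2 fun i hi =>
        eventually_differentiableAt_iterDeriv (hf i hi) L
    filter_upwards [ih.fderiv (𝕜 := ℂ), h] with x hx hd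
    have h1 : HasFDerivAt (fun x => ∑ i ∈ s, A i (iterDeriv L (f i) x))
        (∑ i ∈ s, (A i).comp (fderiv ℂ (iterDeriv L (f i)) x)) x :=
      HasFDerivAt.fun_sum fun i hi => (A i).hasFDerivAt.comp x (hd i hi).hasFDerivAt
    simp only [iterDeriv, coordDeriv, hx, h1.fderiv]
    simp

theorem iterDeriv_clm_comp (A : V →L[ℂ] V') {f : Cn r → V} {m : Cn r}
    (hf : ∀ᶠ x in 𝓝 m, DifferentiableAt ℂ f x) (L : List (Fin r)) :
    iterDeriv L (fun x => A (f x)) m = A (iterDeriv L f m) := by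
  have := (iterDeriv_sum_clm (Finset.univ : Finset Unit) (fun _ => A) (f := fun _ => f)
    (fun _ _ => hf) L).self_of_nhds
  simpa using this

theorem iterDeriv_add {f g : Cn r → V} (hf : Differentiable ℂ f) (hg : Differentiable ℂ g)
    (L : List (Fin r)) : iterDeriv L (f + g) = iterDeriv L f + iterDeriv L g := by
  induction L with
  | nil => rfl
  | cons l L ih =>
    funext x
    simp only [iterDeriv, ih, coordDeriv, Pi.add_apply]
    rw [fderiv_add (differentiable_iterDeriv hf L x) (differentiable_iterDeriv hg L x)]
    rfl

theorem iterDeriv_smul (a : ℂ) {f : Cn r → V} (hf : Differentiable ℂ f) (L : List (Fin r)) :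
    iterDeriv L (a • f) = a • iterDeriv L f := by
  induction L with
  | nil => rfl
  | cons l L ih =>
    funext x
    simp only [iterDeriv, ih, coordDeriv, Pi.smul_apply]
    rw [fderiv_const_smul (differentiable_iterDeriv hf L x)]
    rfl

/-- Any linear condition with constant coefficients passes to Taylor parts. It is applied below to
semi-basicness, to closedness and to the relation ∑ ω_i = 0. -/
theorem taylorPart_sum_clm {ι : Type*} (s : Finset ι) (A : ι → V →L[ℂ] V') (k : ℕ)
    {f : ι → Cn r → V} (hf : ∀ i ∈ s, ∀ᶠ x in 𝓝 0, DifferentiableAt ℂ (f i) x) (x : Cn r) :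
    taylorPart k (fun x => ∑ i ∈ s, A i (f i x)) x = ∑ i ∈ s, A i (taylorPart k (f i) x) := by
  simp only [taylorPart, (iterDeriv_sum_clm s A hf _).self_of_nhds, polyOfJet_sum_clm]

end IterDeriv

/-! ### Jets of homogeneous forms, exactness of the Koszul complex and the numbers z. -/

section FormJet

variable {r p k : ℕ}

/-- The derivatives of order `k` at the origin of the coefficients of a form. -/
def formJet (r p k : ℕ) :
    homMaps r k (AltForm r p) →ₗ[ℂ] (Increasing p r × MultiIndex r k → ℂ) where
  toFun θ AK := iterDeriv AK.2.toList θ.1 0 (coordVec AK.1)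
  map_add' θ η := by
    funext AK
    simp [iterDeriv_add θ.2.1 η.2.1]
  map_smul' a θ := by
    funext AK
    simp [iterDeriv_smul a θ.2.1]

theorem formJet_injective : Function.Injective (formJet r p k) := by
  refine (injective_iff_map_eq_zero _).2 ?_
  rintro ⟨θ, hθ⟩ h
  refine Subtype.ext (eq_zero_of_mem_homMaps hθ fun L hL => altForm_ext fun A => ?_)
  have h1 := congrFun h (A, MultiIndex.ofList L hL)
  rw [← (iterDeriv_perm (.of_forall hθ.1) (MultiIndex.toList_ofList L hL)).self_of_nhds]
  exact h1

theorem formJet_surjective : Function.Surjective (formJet r p k) := by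
  intro w
  -- `polyOfJet k` reads only lists of length k; the value 0 elsewhere merely makes W total and
  -- permutation invariant.
  set W : List (Fin r) → AltForm r p := fun L =>
    if hL : L.length = k then ∑ A, w (A, MultiIndex.ofList L hL) • basisForm A else 0 with hW
  have hinv : ∀ L L' : List (Fin r), L.Perm L' → W L = W L' := by
    intro L L' h
    by_cases hL : L.length = k
    · have hL' : L'.length = k := h.length_eq ▸ hL
      have : MultiIndex.ofList L hL = MultiIndex.ofList L' hL' :=
        Subtype.ext (funext fun j => h.count_eq j)
      simp [hW, hL, hL', this]
    · have hL' : ¬ L'.length = k := h.length_eq ▸ hL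
      simp [hW, hL, hL']
  refine ⟨⟨polyOfJet k W, polyOfJet_mem_homMaps k W⟩, ?_⟩
  funext ⟨A, K⟩
  change iterDeriv K.toList (polyOfJet k W) 0 (coordVec A) = _
  rw [iterDeriv_polyOfJet hinv K.length_toList]
  have h1 : MultiIndex.ofList K.toList K.length_toList = K :=
    MultiIndex.eq_of_perm (MultiIndex.toList_ofList _ _)
  simp only [hW, K.length_toList, dif_pos, h1]
  exact sum_smul_basisForm_apply (fun A => w (A, K)) A

/-- Homogeneous forms are determined by arbitrary jets at the origin. -/
def formJetEquiv (r p k : ℕ) :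
    homMaps r k (AltForm r p) ≃ₗ[ℂ] (Increasing p r × MultiIndex r k → ℂ) :=
  LinearEquiv.ofBijective (formJet r p k) ⟨formJet_injective, formJet_surjective⟩

theorem extDeriv_apply_eq_sum (θ : Form r p) (x : Cn r) (v : Fin (p + 1) → Cn r) :
    extDeriv θ x v = ∑ j : Fin (p + 1), (-1) ^ (j : ℕ) * fderiv ℂ θ x (v j) (j.removeNth v) := by
  rw [extDeriv, ContinuousAlternatingMap.alternatizeUncurryFin_apply]
  simp [zsmul_eq_mul]

theorem extDeriv_mem_homMaps {θ : Form r p} (hθ : θ ∈ homMaps r (k + 1) (AltForm r p)) :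
    extDeriv θ ∈ homMaps r k (AltForm r (p + 1)) := by
  refine ⟨fun x => ?_, fun t x => ?_⟩
  · exact (ContinuousAlternatingMap.alternatizeUncurryFinCLM ℂ (Cn r) ℂ).differentiableAt.comp x
      (differentiableAt_fderiv (.of_forall hθ.1))
  · rw [extDeriv, fderiv_smul_of_mem_homMaps hθ,
      ContinuousAlternatingMap.alternatizeUncurryFin_smul]
    rfl

theorem extDeriv_of_mem_homMaps_zero {θ : Form r p} (hθ : θ ∈ homMaps r 0 (AltForm r p))
    (x : Cn r) : extDeriv θ x = 0 := by
  ext v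
  simp [extDeriv_apply_eq_sum, fderiv_of_mem_homMaps_zero hθ]

/-- The coefficient of dθ at C is the alternating sum of the ∂_{C_j} of the coefficients of θ at C
without C_j, and ∂_K ∂_{C_j} is the derivative of multi-index K + 1_{C_j}. The Koszul complex can
thus be studied through actual differential forms. -/
theorem formJet_extDeriv (θ : homMaps r (k + 1) (AltForm r p)) :
    formJet r (p + 1) k ⟨extDeriv θ.1, extDeriv_mem_homMaps θ.2⟩ =
      koszulD r p k (formJet r p (k + 1) θ) := by
  funext ⟨C, K⟩
  have hd : ∀ j : Fin (p + 1), ∀ᶠ x in 𝓝 (0 : Cn r),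
      DifferentiableAt ℂ (coordDeriv (C j) θ.1) x := fun j =>
    .of_forall (differentiable_coordDeriv θ.2.1 _)
  have h1 : (fun x => evalForm (coordVec C) (extDeriv θ.1 x)) = fun x => ∑ j : Fin (p + 1),
      ((-1 : ℂ) ^ (j : ℕ) • evalForm (coordVec ((Fin.succAboveOrderEmb j).trans C)) :
        AltForm r p →L[ℂ] ℂ) (coordDeriv (C j) θ.1 x) := by
    funext x
    rw [evalForm_apply, extDeriv_apply_eq_sum]
    exact Finset.sum_congr rfl fun j _ => rfl
  have h2 := iterDeriv_clm_comp (evalForm (coordVec C)) (m := 0)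
    (.of_forall (extDeriv_mem_homMaps θ.2).1) K.toList
  rw [h1, (iterDeriv_sum_clm _ _ (fun j _ => hd j) _).self_of_nhds] at h2
  change evalForm (coordVec C) (iterDeriv K.toList (extDeriv θ.1) 0) = _
  rw [← h2]
  refine Finset.sum_congr rfl fun j _ => ?_
  rw [smul_apply, smul_eq_mul]
  refine congrArg _ ?_
  change _ = iterDeriv (K.succ (C j)).toList θ.1 0 _
  rw [(iterDeriv_perm (.of_forall θ.2.1) (K.toList_succ (C j))).self_of_nhds, iterDeriv_append]
  rfl

theorem formJet_mem_koszulKer_iff (θ : homMaps r k (AltForm r p)) :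
    formJet r p k θ ∈ koszulKer r p k ↔ ∀ x, extDeriv θ.1 x = 0 := by
  cases k with
  | zero => simp [koszulKer, extDeriv_of_mem_homMaps_zero θ.2]
  | succ k =>
    rw [koszulKer, LinearMap.mem_ker, ← formJet_extDeriv,
      map_eq_zero_iff _ formJet_injective, ← Submodule.coe_eq_zero]
    exact funext_iff

/-- The contraction of a form with the Euler field. -/
def eulerContract (θ : Form r (p + 1)) : Form r p := fun x =>
  ContinuousAlternatingMap.curryLeft (θ x) x

theorem hasFDerivAt_clm_apply_self {E V V' : Type*} [NormedAddCommGroup E] [NormedSpace ℂ E]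
    [NormedAddCommGroup V] [NormedSpace ℂ V] [NormedAddCommGroup V'] [NormedSpace ℂ V']
    (Λ : V →L[ℂ] E →L[ℂ] V') {θ : E → V} {x : E} (hθ : DifferentiableAt ℂ θ x) :
    HasFDerivAt (fun x => Λ (θ x) x) ((Λ.comp (fderiv ℂ θ x)).flip x + Λ (θ x)) x := by
  rw [add_comm]
  exact (Λ.hasFDerivAt.comp x hθ.hasFDerivAt).clm_apply (hasFDerivAt_id x)

/-- The contraction of alternating forms as a continuous linear map. -/
def curryLeftMap (r p : ℕ) : AltForm r (p + 1) →L[ℂ] Cn r →L[ℂ] AltForm r p :=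
  (ContinuousAlternatingMap.curryLeftLI (𝕜 := ℂ) (E := Cn r) (F := ℂ)
    (n := p)).toContinuousLinearMap

theorem hasFDerivAt_eulerContract {θ : Form r (p + 1)} {x : Cn r}
    (hθ : DifferentiableAt ℂ θ x) :
    HasFDerivAt (eulerContract θ)
      (((curryLeftMap r p).comp (fderiv ℂ θ x)).flip x +
        ContinuousAlternatingMap.curryLeft (θ x)) x :=
  hasFDerivAt_clm_apply_self (curryLeftMap r p) hθ

/-- Cartan's formula for the Euler field E: since i_E dθ = 0, d(i_E θ) is the Lie derivative of θ.
The coefficients contribute k by Euler's identity, and the p + 1 covectors contribute p + 1. -/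
theorem extDeriv_eulerContract {θ : Form r (p + 1)} (hθ : θ ∈ homMaps r k (AltForm r (p + 1)))
    {x : Cn r} (hc : extDeriv θ x = 0) :
    extDeriv (eulerContract θ) x = ((k : ℂ) + (p + 1)) • θ x := by
  rw [extDeriv, (hasFDerivAt_eulerContract hθ.1.differentiableAt).fderiv,
    ContinuousAlternatingMap.alternatizeUncurryFin_add,
    ContinuousAlternatingMap.alternatizeUncurryFin_curryLeft]
  have h0 : (p + 1) • θ x = ((p : ℂ) + 1) • θ x := by
    rw [← Nat.cast_smul_eq_nsmul ℂ]
    push_cast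
    rfl
  have h00 : ((k : ℂ) + (p + 1)) • θ x = (k : ℂ) • θ x + ((p : ℂ) + 1) • θ x := by
    ext v
    simp only [ContinuousAlternatingMap.add_apply, ContinuousAlternatingMap.smul_apply, smul_eq_mul]
    ring
  rw [h0, h00, add_left_inj]
  ext v
  -- Evaluating dθ = 0 on (x, v) expresses the Euler derivative of θ as the alternating sum produced
  -- by d(i_E θ).
  have h1 := congrArg (fun η : AltForm r (p + 2) => η (Matrix.vecCons x v)) hc
  simp only [extDeriv_apply_eq_sum, Fin.sum_univ_succ (n := p + 1)] at h1
  rw [ContinuousAlternatingMap.alternatizeUncurryFin_apply,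
    ← fderiv_self_of_mem_homMaps hθ x]
  simp only [Fin.val_zero, pow_zero, one_mul, Matrix.cons_val_zero, Fin.val_succ, pow_succ,
    Matrix.cons_val_succ] at h1
  have h4 : Fin.removeNth 0 (Matrix.vecCons x v) = v := by
    funext i; simp [Fin.removeNth_apply]
  have h5 : ∀ j : Fin (p + 1), Fin.removeNth j.succ (Matrix.vecCons x v) =
      Matrix.vecCons x (j.removeNth v) := by
    intro j; funext i
    cases i using Fin.cases <;> simp [Fin.removeNth_apply]
  simp only [h4, h5, mul_neg, mul_one, neg_mul, Finset.sum_neg_distrib] at h1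
  have h6 : (fderiv ℂ θ x x) v - ∑ j : Fin (p + 1), (-1) ^ (j : ℕ) *
      (fderiv ℂ θ x (v j)) (Matrix.vecCons x (j.removeNth v)) = 0 := by
    rw [sub_eq_add_neg]; exact h1
  rw [sub_eq_zero] at h6
  rw [h6]
  refine Finset.sum_congr rfl fun j _ => ?_
  rw [zsmul_eq_mul]
  push_cast
  rfl

theorem eulerContract_mem_homMaps {θ : Form r (p + 1)}
    (hθ : θ ∈ homMaps r k (AltForm r (p + 1))) :
    eulerContract θ ∈ homMaps r (k + 1) (AltForm r p) := by
  refine ⟨fun x => (hasFDerivAt_eulerContract hθ.1.differentiableAt).differentiableAt,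
    fun t x => ?_⟩
  simp [eulerContract, hθ.2, pow_succ, smul_smul, mul_comm]

/-- Exactness of the Koszul complex. -/
theorem range_koszulD (r p k : ℕ) :
    LinearMap.range (koszulD r p k) = koszulKer r (p + 1) k := by
  apply le_antisymm
  · rintro _ ⟨w, rfl⟩
    obtain ⟨θ, rfl⟩ := formJet_surjective w
    rw [← formJet_extDeriv, formJet_mem_koszulKer_iff]
    intro x
    exact congrFun (extDeriv_extDeriv (contDiff_of_differentiable θ.2.1 2) (by simp)) x
  · intro w hw
    obtain ⟨θ, rfl⟩ := formJet_surjective w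
    rw [formJet_mem_koszulKer_iff] at hw
    -- The form degree p + 1 is positive, so the homotopy factor is invertible even for k = 0.
    have hne : (k : ℂ) + (p + 1) ≠ 0 := by exact_mod_cast (by omega : k + (p + 1) ≠ 0)
    refine ⟨((k : ℂ) + (p + 1))⁻¹ •
      formJet r p (k + 1) ⟨eulerContract θ.1, eulerContract_mem_homMaps θ.2⟩, ?_⟩
    rw [map_smul, ← formJet_extDeriv, ← map_smul]
    congr 1
    apply Subtype.ext
    funext x
    change ((k : ℂ) + (p + 1))⁻¹ • extDeriv (eulerContract θ.1) x = θ.1 x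
    rw [extDeriv_eulerContract θ.2 (hw x), smul_smul, inv_mul_cancel₀ hne, one_smul]

theorem z_zero (r p : ℕ) : z r p 0 = b r p := by
  rw [z]
  by_cases h : p ≤ r
  · have : (Finset.Icc p r).filter (fun j => j ≤ 0 + p) = {p} := by
      ext j; simp; omega
    rw [this]
    simp [c, b]
  · have : (Finset.Icc p r).filter (fun j => j ≤ 0 + p) = ∅ := by
      ext j; simp; omega
    rw [this]
    simp [b, Nat.choose_eq_zero_of_lt (not_le.1 h)]

/-- Splitting off the term j = p gives the recursion that rank-nullity imposes on the dimensions of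
the Koszul kernels. -/
theorem z_succ (r p k : ℕ) : z r p (k + 1) = b r p * c r (k + 1) - z r (p + 1) k := by
  rw [z, z]
  by_cases h : p ≤ r
  · have : (Finset.Icc p r).filter (fun j => j ≤ k + 1 + p) =
        insert p ((Finset.Icc (p + 1) r).filter (fun j => j ≤ k + (p + 1))) := by
      ext j; simp; omega
    rw [this, Finset.sum_insert (by simp), sub_eq_add_neg, ← Finset.sum_neg_distrib]
    congr 1
    · simp
    · refine Finset.sum_congr rfl fun j hj => ?_
      simp only [Finset.mem_filter, Finset.mem_Icc] at hj
      rw [show j - p = j - (p + 1) + 1 by omega, pow_succ,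
        show k + 1 + p - j = k + (p + 1) - j by omega]
      ring
  · rw [Finset.Icc_eq_empty (by omega), Finset.Icc_eq_empty (by omega)]
    simp [b, Nat.choose_eq_zero_of_lt (not_le.1 h)]

theorem finrank_jets (r p k : ℕ) :
    Module.finrank ℂ (Increasing p r × MultiIndex r k → ℂ) = b r p * c r k := by
  rw [Module.finrank_fintype_fun_eq_card, Fintype.card_prod, card_increasing, card_multiIndex]

/-- By exactness, the image of the differential on S^(k+1) ⊗ Λ^p is the kernel in S^k ⊗ Λ^(p+1),
known by induction on k for all p. -/
theorem finrank_koszulKer (r p k : ℕ) : (Module.finrank ℂ (koszulKer r p k) : ℤ) = z r p k := by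
  induction k generalizing p with
  | zero =>
    rw [koszulKer, finrank_top, finrank_jets, z_zero]
    simp [c, b]
  | succ k ih =>
    have h := (koszulD r p k).finrank_range_add_finrank_ker
    rw [range_koszulD, finrank_jets] at h
    rw [z_succ, ← ih (p + 1), koszulKer]
    have h' := congrArg (Nat.cast : ℕ → ℤ) h
    push_cast at h'
    linarith

end FormJet

/-! ### The symbols of the coefficients `M_L^K` -/

section Symbol

variable {n q : ℕ}

/-- The coefficients of the formula `∂_L (f ∘ Λ) = ∑_K M_L^K ((∂_K f) ∘ Λ)`, `Λ` linear. -/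
def symbolCoeff (Λ : Cn n →L[ℂ] Cn q) : List (Fin n) → (Fin q → ℕ) → ℂ
  | [], K => if K = 0 then 1 else 0
  | l :: L, K => ∑ α, if 0 < K α then
      symbolCoeff Λ L (K - Pi.single α 1) * Λ (Pi.single l 1) α else 0

theorem sum_sub_single {K : Fin q → ℕ} {α : Fin q} (h : 0 < K α) :
    ∑ j, (K - Pi.single α 1 : Fin q → ℕ) j + 1 = ∑ j, K j := by
  have h1 : K = (K - Pi.single α 1) + Pi.single α 1 := by
    funext j
    by_cases hj : j = α
    · subst hj; simp; omega
    · simp [hj]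
  conv_rhs => rw [h1]
  simp [Finset.sum_add_distrib]

/-- Each derivation raises the order of differentiation of f by at most one. Vanishing is needed as
a function, because the recursion differentiates the coefficient. -/
theorem jetCoeff_of_lt (u : Cn n → Cn q) (J : Cn n → ℂ) (L : List (Fin n)) (K : Fin q → ℕ)
    (h : L.length < ∑ j, K j) : jetCoeff u J L K = fun _ => 0 := by
  induction L generalizing K with
  | nil =>
    have : K ≠ 0 := by rintro rfl; simp at h
    simp only [jetCoeff, if_neg this]
    rfl
  | cons l L ih =>
    funext x
    rw [jetCoeff, ih K (by simp at h; omega)]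
    have : ∀ α, 0 < K α → jetCoeff u J L (K - Pi.single α 1) = fun _ => 0 := fun α hα =>
      ih _ (by have := sum_sub_single hα; simp at h; omega)
    simp only [partialDeriv, fderiv_fun_const, Pi.zero_apply, zero_apply,
      zero_add]
    refine Finset.sum_eq_zero fun α _ => ?_
    split_ifs with hα
    · simp [this α hα]
    · rfl

theorem partialDeriv_comp {u : Cn n → Cn q} {x : Cn n} (hu : DifferentiableAt ℂ u x)
    (l : Fin n) (α : Fin q) :
    partialDeriv l (fun y => u y α) x = fderiv ℂ u x (Pi.single l 1) α := by
  have h := (ContinuousLinearMap.proj (R := ℂ) (φ := fun _ : Fin q => ℂ) α).hasFDerivAt.comp x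
    hu.hasFDerivAt
  rw [partialDeriv, show (fun y => u y α) =
    (ContinuousLinearMap.proj (R := ℂ) (φ := fun _ : Fin q => ℂ) α) ∘ u from rfl, h.fderiv]
  rfl

/-- In top order the derivative term of the recursion vanishes by `jetCoeff_of_lt`, so no second
derivative of u and no derivative of J enters. -/
theorem jetCoeff_of_eq {u : Cn n → Cn q} (J : Cn n → ℂ) {x : Cn n}
    (hu : DifferentiableAt ℂ u x) (L : List (Fin n)) (K : Fin q → ℕ)
    (h : ∑ j, K j = L.length) :
    jetCoeff u J L K x = J x * symbolCoeff (fderiv ℂ u x) L K := by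
  induction L generalizing K with
  | nil => simp only [jetCoeff, symbolCoeff]; split_ifs <;> simp
  | cons l L ih =>
    rw [jetCoeff, jetCoeff_of_lt u J L K (by simp [h]), symbolCoeff, Finset.mul_sum]
    simp only [partialDeriv, fderiv_fun_const, Pi.zero_apply, zero_apply,
      zero_add]
    refine Finset.sum_congr rfl fun α _ => ?_
    split_ifs with hα
    · have h2 := partialDeriv_comp hu l α
      rw [partialDeriv] at h2
      rw [ih _ (by have := sum_sub_single hα; simp at h; omega), h2, mul_assoc]
    · simp

/-- K ↦ K + 1_α is a bijection onto the multi-indices with positive α-entry, the condition tested in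
the recursion of `symbolCoeff`. -/
theorem sum_multiIndex_succ {k : ℕ} {V : Type*} [AddCommMonoid V] (α : Fin q)
    (F : MultiIndex q (k + 1) → (Fin q → ℕ) → V) :
    ∑ K : MultiIndex q k, F (K.succ α) K.1 =
      ∑ K : MultiIndex q (k + 1), if 0 < K.1 α then F K (K.1 - Pi.single α 1) else 0 := by
  rw [← Finset.sum_filter]
  have h0 : ∀ K : MultiIndex q k, (K.succ α).1 - Pi.single α 1 = K.1 := fun K => by
    simp [MultiIndex.succ]
  refine Finset.sum_bij (fun K _ => K.succ α) ?_ ?_ ?_ ?_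
  · intro K _
    simp [MultiIndex.succ]
  · intro K _ K' _ hK
    exact Subtype.ext (by rw [← h0 K, ← h0 K', hK])
  · intro K hK
    have hα : 0 < K.1 α := by simpa using hK
    refine ⟨⟨K.1 - Pi.single α 1, by have := sum_sub_single hα; have := K.2; omega⟩,
      Finset.mem_univ _, Subtype.ext (funext fun j => ?_)⟩
    by_cases hj : j = α
    · subst hj; simp [MultiIndex.succ]; omega
    · simp [MultiIndex.succ, hj]
  · intro K _
    rw [h0]

/-- For linear Λ the chain rule has no lower-order terms. -/
theorem iterDeriv_comp_linear {V : Type*} [NormedAddCommGroup V] [NormedSpace ℂ V]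
    [FiniteDimensional ℂ V] (Λ : Cn n →L[ℂ] Cn q) {f : Cn q → V} (hf : Differentiable ℂ f)
    {k : ℕ} (L : List (Fin n)) (hL : L.length = k) :
    iterDeriv L (fun x => f (Λ x)) = fun x =>
      ∑ K : MultiIndex q k, symbolCoeff Λ L K.1 • iterDeriv K.toList f (Λ x) := by
  induction L generalizing k with
  | nil =>
    subst hL
    funext x
    have h1 : ∀ K : MultiIndex q 0, K.toList = [] := fun K =>
      List.length_eq_zero_iff.1 K.length_toList
    have h2 : ∀ K : MultiIndex q 0, K.1 = 0 := fun K => by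
      funext j; rw [← K.count_toList, h1]; rfl
    have h3 : Fintype.card (MultiIndex q 0) = 1 := by
      rw [card_multiIndex]; simp [c, b]
    simp only [iterDeriv, symbolCoeff, h1, h2, if_true, one_smul]
    simp only [List.length_nil, Finset.sum_const, Finset.card_univ]
    rw [h3, one_smul]
  | cons l L ih =>
    obtain ⟨k, rfl⟩ : ∃ k', k = k' + 1 := ⟨L.length, by simpa using hL.symm⟩
    funext x
    have hd : ∀ L', Differentiable ℂ (iterDeriv L' f) := differentiable_iterDeriv hf
    have h1 : HasFDerivAt (fun x => ∑ K : MultiIndex q k,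
        symbolCoeff Λ L K.1 • iterDeriv K.toList f (Λ x))
        (∑ K : MultiIndex q k, symbolCoeff Λ L K.1 •
          (fderiv ℂ (iterDeriv K.toList f) (Λ x)).comp Λ) x :=
      HasFDerivAt.fun_sum fun K _ =>
        ((hd K.toList (Λ x)).hasFDerivAt.comp x Λ.hasFDerivAt).const_smul _
    rw [iterDeriv, coordDeriv, ih (by simpa using hL), h1.fderiv]
    simp only [sum_apply, smul_apply, ContinuousLinearMap.comp_apply, fderiv_eq_sum_coordDeriv,
      Finset.smul_sum]
    rw [Finset.sum_comm]
    simp only [symbolCoeff, Finset.sum_smul]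
    rw [Finset.sum_comm (s := (Finset.univ : Finset (MultiIndex q (k + 1))))]
    refine Finset.sum_congr rfl fun α _ => ?_
    simp only [ite_smul, zero_smul]
    rw [← sum_multiIndex_succ α fun K' K => (symbolCoeff Λ L K * Λ (Pi.single l 1) α) •
      iterDeriv K'.toList f (Λ x)]
    refine Finset.sum_congr rfl fun K _ => ?_
    rw [smul_smul]
    refine congrArg _ ?_
    have hp : (K.succ α).toList.Perm (α :: K.toList) :=
      (K.toList_succ α).trans List.perm_append_comm
    rw [(iterDeriv_perm (.of_forall hf) hp).self_of_nhds]
    rfl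

end Symbol

/-! ### Pullback of homogeneous forms by linear maps -/

section Pullback

variable {n q p k : ℕ}

/-- The pullback of a form by a linear map. -/
def linPullback (Λ : Cn n →L[ℂ] Cn q) (θ : Form q p) : Form n p := fun x =>
  (θ (Λ x)).compContinuousLinearMap Λ

theorem linPullback_mem_homMaps (Λ : Cn n →L[ℂ] Cn q) {θ : Form q p}
    (hθ : θ ∈ homMaps q k (AltForm q p)) : linPullback Λ θ ∈ homMaps n k (AltForm n p) := by
  refine ⟨fun x => ?_, fun t x => ?_⟩
  · exact DifferentiableAt.continuousAlternatingMapCompContinuousLinearMap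
      (f := fun x => θ (Λ x)) (g := fun _ => Λ) ((hθ.1 _).comp x Λ.differentiableAt)
      (differentiableAt_const _)
  · ext v
    simp [linPullback, hθ.2]

theorem extDeriv_linPullback (Λ : Cn n →L[ℂ] Cn q) {θ : Form q p} (hθ : Differentiable ℂ θ)
    (x : Cn n) : extDeriv (linPullback Λ θ) x = (extDeriv θ (Λ x)).compContinuousLinearMap Λ := by
  have h := extDeriv_pullback (ω := θ) (f := Λ) (x := x) (r := 2) (hθ _)
    Λ.contDiff.contDiffAt (by simp)
  simp only [ContinuousLinearMap.fderiv] at h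
  exact h

theorem formJet_linPullback (Λ : Cn n →L[ℂ] Cn q) (θ : homMaps q k (AltForm q p))
    (B : Increasing p n) (L : MultiIndex n k) :
    formJet n p k ⟨linPullback Λ θ.1, linPullback_mem_homMaps Λ θ.2⟩ (B, L) =
      ∑ A : Increasing p q, ∑ K : MultiIndex q k,
        Matrix.det (Matrix.of fun s t => Λ (coordVec B s) (A t)) *
          symbolCoeff Λ L.toList K.1 * formJet q p k θ (A, K) := by
  have h1 := iterDeriv_clm_comp (evalForm (coordVec B)) (m := 0)
    (.of_forall (linPullback_mem_homMaps Λ θ.2).1) L.toList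
  change evalForm (coordVec B) (iterDeriv L.toList (linPullback Λ θ.1) 0) = _
  rw [← h1]
  have h2 := iterDeriv_clm_comp (f := fun x => θ.1 (Λ x))
    (evalForm (fun s => Λ (coordVec B s))) (m := 0)
    (.of_forall fun x => (θ.2.1 _).comp x Λ.differentiableAt) L.toList
  refine h2.trans ?_
  rw [iterDeriv_comp_linear Λ θ.2.1 L.toList L.length_toList, map_sum, Finset.sum_comm]
  refine Finset.sum_congr rfl fun K _ => ?_
  rw [map_smul, evalForm_apply, altForm_apply_eq_sum, smul_eq_mul, Finset.mul_sum, map_zero]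
  refine Finset.sum_congr rfl fun A _ => ?_
  change _ = _ * _ * iterDeriv K.toList θ.1 0 (coordVec A)
  ring

/-- This turns the rank condition into geometry: through jets, P_k is the map (θ_i) ↦ ∑ du_i(m)^*
θ_i on homogeneous forms of degree k. -/
theorem P_mulVec_formJet {d : ℕ} {u : Fin d → Cn n → Cn q} {m : Cn n}
    (hu : ∀ i, DifferentiableAt ℂ (u i) m) (θ : Fin d → homMaps q k (AltForm q p)) :
    (P u m p k).mulVec (fun iAK => formJet q p k (θ iAK.1) iAK.2) =
      ∑ i, formJet n p k ⟨linPullback (fderiv ℂ (u i) m) (θ i).1,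
        linPullback_mem_homMaps _ (θ i).2⟩ := by
  funext ⟨B, L⟩
  rw [Finset.sum_apply, Matrix.mulVec, dotProduct, Fintype.sum_prod_type]
  refine Finset.sum_congr rfl fun i _ => ?_
  rw [formJet_linPullback, Fintype.sum_prod_type]
  refine Finset.sum_congr rfl fun A _ => Finset.sum_congr rfl fun K _ => ?_
  congr 1
  change jetCoeff (u i) (jacobianMinor (u i) A B) L.toList K.1 m = _
  rw [jetCoeff_of_eq _ (hu i) _ _ (by rw [K.2, L.length_toList])]
  congr 1
  -- The Jacobian minor has its rows indexed by A, the expansion of the pullback by B.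
  rw [jacobianMinor, ← Matrix.det_transpose]
  congr 1
  ext s t
  simp [partialDeriv_comp (hu i), coordVec]

end Pullback

/-! ### Homogeneous abelian relations of a family of linear foliations -/

section Relations

variable {n q p d : ℕ}

/-- The homogeneous forms of degree `k` which are basic for the foliation of `ℂⁿ` by translates of
`T`, closed if `cl` holds. -/
def basicForms (p : ℕ) (T : Submodule ℂ (Cn n)) (cl : Prop) (k : ℕ) : Submodule ℂ (Form n p) where
  carrier := {θ | θ ∈ homMaps n k (AltForm n p) ∧ (∀ x, Kills T (θ x)) ∧
    (∀ x, ∀ v ∈ T, θ (x + v) = θ x) ∧ (cl → ∀ x, extDeriv θ x = 0)}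
  zero_mem' := ⟨zero_mem _, fun _ => Kills.zero _, fun _ _ _ => rfl,
    fun _ => extDeriv_zero_form⟩
  add_mem' := fun h h' => ⟨add_mem h.1 h'.1, fun x => (h.2.1 x).add (h'.2.1 x),
    fun x v hv => by simp [h.2.2.1 x v hv, h'.2.2.1 x v hv],
    fun hc x => by rw [extDeriv_add (h.1.1 x) (h'.1.1 x), h.2.2.2 hc, h'.2.2.2 hc, add_zero]⟩
  smul_mem' := fun a θ h => ⟨Submodule.smul_mem _ a h.1, fun x => (h.2.1 x).smul a,
    fun x v hv => by simp [h.2.2.1 x v hv],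
    fun hc x => by rw [extDeriv_smul, h.2.2.2 hc, smul_zero]⟩

/-- The homogeneous abelian relations of degree `k` of the foliations of `ℂⁿ` by translates of
the subspaces `T i`; they are closed if `cl` holds. -/
def homRelations (p : ℕ) (T : Fin d → Submodule ℂ (Cn n)) (cl : Prop) (k : ℕ) :
    Submodule ℂ (Fin d → Form n p) where
  carrier := {θ | (∀ i, θ i ∈ basicForms p (T i) cl k) ∧ ∑ i, θ i = 0}
  zero_mem' := ⟨fun _ => zero_mem _, by simp⟩
  add_mem' := fun h h' => ⟨fun i => add_mem (h.1 i) (h'.1 i), by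
    simp [Finset.sum_add_distrib, h.2, h'.2]⟩
  smul_mem' := fun a θ h => ⟨fun i => Submodule.smul_mem _ a (h.1 i), by
    simp [← Finset.smul_sum, h.2]⟩

/-- The arguments are replaced one at a time; each difference lies in S and contributes zero. -/
theorem Kills.apply_eq {r : ℕ} {S : Submodule ℂ (Cn n)} {η : AltForm n r} (h : Kills S η)
    {v w : Fin r → Cn n} (hvw : ∀ j, w j - v j ∈ S) : η w = η v := by
  classical
  have key : ∀ s : Finset (Fin r), η (s.piecewise w v) = η v := by
    intro s
    induction s using Finset.induction_on with
    | empty => simp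
    | insert j s hj ih =>
      rw [Finset.piecewise_insert, ← ih]
      have h1 : w j = v j + (w j - v j) := by abel
      have h2 : η (Function.update (s.piecewise w v) j (w j - v j)) = 0 :=
        h _ ⟨j, by simpa using hvw j⟩
      rw [h1, η.map_update_add, h2, add_zero]
      congr 1
      rw [Function.update_eq_self_iff]
      simp [hj]
  simpa using key Finset.univ

theorem linPullback_mem_basicForms_iff {Λ : Cn n →L[ℂ] Cn q} (hΛ : Function.Surjective Λ)
    {cl : Prop} {k : ℕ} {θ : Form q p} (hθ : θ ∈ homMaps q k (AltForm q p)) :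
    linPullback Λ θ ∈ basicForms p (LinearMap.ker Λ.toLinearMap) cl k ↔
      (cl → ∀ x, extDeriv θ x = 0) := by
  have h1 : (∀ x, extDeriv (linPullback Λ θ) x = 0) ↔ ∀ x, extDeriv θ x = 0 := by
    simp only [extDeriv_linPullback Λ hθ.1]
    refine ⟨fun h y => ?_, fun h x => by rw [h]; rfl⟩
    obtain ⟨x, rfl⟩ := hΛ y
    ext w
    choose s hs using hΛ
    have h2 := congrArg (fun η : AltForm n (p + 1) => η fun j => s (w j)) (h x)
    simpa [Function.comp_def, hs] using h2
  constructor
  · exact fun h hc => h1.1 (h.2.2.2 hc)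
  · refine fun h => ⟨linPullback_mem_homMaps Λ hθ, fun x w ⟨j, hj⟩ => ?_, fun x v hv => ?_,
      fun hc => h1.2 (h hc)⟩
    · exact (θ (Λ x)).map_coord_zero j hj
    · have hv' : Λ v = 0 := hv
      simp [linPullback, hv']

/-- The form downstairs is the pullback of η by a linear section s of Λ. Since sΛy - y lies in the
kernel, invariance moves the base point back and semi-basicness moves the arguments back. -/
theorem exists_linPullback_eq {Λ : Cn n →L[ℂ] Cn q} (hΛ : Function.Surjective Λ)
    {cl : Prop} {k : ℕ} {η : Form n p}
    (hη : η ∈ basicForms p (LinearMap.ker Λ.toLinearMap) cl k) :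
    ∃ θ ∈ homMaps q k (AltForm q p), linPullback Λ θ = η := by
  obtain ⟨s, hs⟩ := Λ.toLinearMap.exists_rightInverse_of_surjective (LinearMap.range_eq_top.2 hΛ)
  have hs' : ∀ y, Λ (s y) = y := fun y => congrArg (fun f : Cn q →ₗ[ℂ] Cn q => f y) hs
  refine ⟨linPullback s.toContinuousLinearMap η, linPullback_mem_homMaps _ hη.1, ?_⟩
  funext x
  have hker : ∀ y, s (Λ y) - y ∈ LinearMap.ker Λ.toLinearMap := fun y => by
    change Λ (s (Λ y) - y) = 0
    rw [map_sub, hs', sub_self]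
  have h1 : η (s (Λ x)) = η x := by
    have := hη.2.2.1 x _ (hker x)
    rwa [add_sub_cancel] at this
  ext v
  change η (s (Λ x)) (fun j => s (Λ (v j))) = η x v
  rw [h1]
  exact (hη.2.1 x).apply_eq fun j => hker _

theorem linPullback_injective {Λ : Cn n →L[ℂ] Cn q} (hΛ : Function.Surjective Λ)
    {θ : Form q p} (h : linPullback Λ θ = 0) : θ = 0 := by
  funext y
  obtain ⟨x, rfl⟩ := hΛ y
  ext w
  choose s hs using hΛ
  have h2 := congrArg (fun η : AltForm n p => η fun j => s (w j)) (congrFun h x)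
  simpa [linPullback, Function.comp_def, hs] using h2

/-- The homogeneous forms on `ℂⁿ` with given jets as forms on `ℂ^q`. -/
def pullbackOfJets (p k : ℕ) (Λ : Fin d → Cn n →L[ℂ] Cn q) :
    (Fin d × Increasing p q × MultiIndex q k → ℂ) →ₗ[ℂ] (Fin d → Form n p) where
  toFun w i := linPullback (Λ i) ((formJetEquiv q p k).symm fun AK => w (i, AK)).1
  map_add' w w' := by
    funext i
    have := map_add (formJetEquiv q p k).symm (fun AK => w (i, AK)) (fun AK => w' (i, AK))
    change linPullback (Λ i) ((formJetEquiv q p k).symm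
      ((fun AK => w (i, AK)) + fun AK => w' (i, AK))).1 = _
    rw [this]
    rfl
  map_smul' a w := by
    funext i
    have := map_smul (formJetEquiv q p k).symm a (fun AK => w (i, AK))
    change linPullback (Λ i) ((formJetEquiv q p k).symm (a • fun AK => w (i, AK))).1 = _
    rw [this]
    rfl

/-- The jets of closed forms if `cl` holds, all jets otherwise. -/
def columnSpace (d q p k : ℕ) (cl : Prop) :
    Submodule ℂ (Fin d × Increasing p q × MultiIndex q k → ℂ) := ⨅ _ : cl, closedColumns d q p k

theorem mem_closedColumns {k : ℕ} {w : Fin d × Increasing p q × MultiIndex q k → ℂ} :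
    w ∈ closedColumns d q p k ↔ ∀ i, (fun AK => w (i, AK)) ∈ koszulKer q p k := by
  simp only [closedColumns, Submodule.mem_iInf, Submodule.mem_comap]
  rfl

/-- Membership in the kernel of P_k says that the pullbacks sum to zero, and membership in the
column space says that they are closed when required. Every relation arises because homogeneous
basic forms descend along the surjection du_i(m). -/
theorem map_pullbackOfJets {u : Fin d → Cn n → Cn q} {m : Cn n}
    (hu : ∀ i, DifferentiableAt ℂ (u i) m) (hs : ∀ i, Function.Surjective (fderiv ℂ (u i) m))
    (cl : Prop) (k : ℕ) :
    (LinearMap.ker (P u m p k).mulVecLin ⊓ columnSpace d q p k cl).map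
      (pullbackOfJets p k fun i => fderiv ℂ (u i) m) =
      homRelations p (fun i => LinearMap.ker (fderiv ℂ (u i) m).toLinearMap) cl k := by
  have key : ∀ w : Fin d × Increasing p q × MultiIndex q k → ℂ,
      w ∈ LinearMap.ker (P u m p k).mulVecLin ⊓ columnSpace d q p k cl ↔
      pullbackOfJets p k (fun i => fderiv ℂ (u i) m) w ∈
      homRelations p (fun i => LinearMap.ker (fderiv ℂ (u i) m).toLinearMap) cl k := by
    intro w
    set θ : Fin d → homMaps q k (AltForm q p) := fun i =>
      (formJetEquiv q p k).symm fun AK => w (i, AK) with hθ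
    have hw : ∀ i, formJet q p k (θ i) = fun AK => w (i, AK) := fun i =>
      (formJetEquiv q p k).apply_symm_apply _
    have h1 : (P u m p k).mulVecLin w = 0 ↔
        ∑ i, pullbackOfJets p k (fun i => fderiv ℂ (u i) m) w i = 0 := by
      have h2 : w = fun iAK => formJet q p k (θ iAK.1) iAK.2 := by
        funext ⟨i, AK⟩
        rw [hw]
      rw [Matrix.mulVecLin_apply]
      conv_lhs => rw [h2]
      rw [P_mulVec_formJet hu, ← map_sum, map_eq_zero_iff _ formJet_injective,
        ← Submodule.coe_eq_zero, Submodule.coe_sum]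
      rfl
    have h3 : w ∈ columnSpace d q p k cl ↔ ∀ i,
        pullbackOfJets p k (fun i => fderiv ℂ (u i) m) w i ∈
          basicForms p (LinearMap.ker (fderiv ℂ (u i) m).toLinearMap) cl k := by
      simp only [columnSpace, Submodule.mem_iInf, mem_closedColumns]
      change _ ↔ ∀ i, linPullback _ (θ i).1 ∈ _
      simp only [linPullback_mem_basicForms_iff (hs _) (θ _).2, ← formJet_mem_koszulKer_iff, hw]
      exact ⟨fun h i hc => h hc i, fun h hc i => h i hc⟩
    rw [Submodule.mem_inf, LinearMap.mem_ker, h1, h3, and_comm]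
    rfl
  ext η
  rw [Submodule.mem_map]
  constructor
  · rintro ⟨w, hw, rfl⟩
    exact (key w).1 hw
  · intro hη
    choose θ hθ hθη using fun i => exists_linPullback_eq (hs i) (hη.1 i)
    have h1 : pullbackOfJets p k (fun i => fderiv ℂ (u i) m)
        (fun iAK => formJet q p k ⟨θ iAK.1, hθ iAK.1⟩ iAK.2) = η := by
      funext i
      rw [← hθη i]
      change linPullback _ ((formJetEquiv q p k).symm (formJetEquiv q p k ⟨θ i, hθ i⟩)).1 = _
      rw [LinearEquiv.symm_apply_apply]
    exact ⟨_, (key _).2 (by rwa [h1]), h1⟩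

theorem pullbackOfJets_injective {Λ : Fin d → Cn n →L[ℂ] Cn q}
    (hs : ∀ i, Function.Surjective (Λ i)) (p k : ℕ) :
    Function.Injective (pullbackOfJets p k Λ) := by
  refine (injective_iff_map_eq_zero _).2 fun w hw => ?_
  funext ⟨i, AK⟩
  have h1 := linPullback_injective (hs i) (congrFun hw i)
  have h2 := congrArg (formJetEquiv q p k) (Subtype.ext h1 : (formJetEquiv q p k).symm
    (fun AK => w (i, AK)) = 0)
  rw [LinearEquiv.apply_symm_apply, map_zero] at h2
  exact congrFun h2 AK

theorem finrank_homRelations_add {u : Fin d → Cn n → Cn q} {m : Cn n}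
    (hu : ∀ i, DifferentiableAt ℂ (u i) m) (hs : ∀ i, Function.Surjective (fderiv ℂ (u i) m))
    (cl : Prop) (k : ℕ) :
    FiniteDimensional ℂ
      (homRelations p (fun i => LinearMap.ker (fderiv ℂ (u i) m).toLinearMap) cl k) ∧
    Module.finrank ℂ
      (homRelations p (fun i => LinearMap.ker (fderiv ℂ (u i) m).toLinearMap) cl k) +
      Module.finrank ℂ (LinearMap.range
        ((P u m p k).mulVecLin.domRestrict (columnSpace d q p k cl))) =
      Module.finrank ℂ (columnSpace d q p k cl) := by
  set f := (P u m p k).mulVecLin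
  set C := columnSpace d q p k cl
  have e1 := Submodule.equivMapOfInjective _ (pullbackOfJets_injective hs p k)
    (LinearMap.ker f ⊓ C)
  rw [map_pullbackOfJets hu hs] at e1
  refine ⟨e1.finiteDimensional, ?_⟩
  rw [← e1.finrank_eq, add_comm, ← (f.domRestrict C).finrank_range_add_finrank_ker]
  congr 1
  rw [LinearMap.ker_domRestrict, inf_comm, ← Submodule.map_comap_subtype,
    Submodule.finrank_map_subtype_eq]

theorem finrank_closedColumns (d q p k : ℕ) :
    (Module.finrank ℂ (closedColumns d q p k) : ℤ) = d * z q p k := by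
  let e : closedColumns d q p k ≃ₗ[ℂ] (Fin d → koszulKer q p k) :=
    { toFun := fun w i => ⟨fun AK => w.1 (i, AK), mem_closedColumns.1 w.2 i⟩
      map_add' := fun _ _ => rfl
      map_smul' := fun _ _ => rfl
      invFun := fun w => ⟨fun iAK => (w iAK.1).1 iAK.2, mem_closedColumns.2 fun i => (w i).2⟩
      left_inv := fun _ => rfl
      right_inv := fun _ => rfl }
  rw [e.finrank_eq, Module.finrank_pi_fintype]
  simp [finrank_koszulKer]

/-- Pullbacks of closed forms are closed; this supplies the bound z(n,p,k) on the rank in place of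
the number of rows. -/
theorem range_PTilde_le {u : Fin d → Cn n → Cn q} {m : Cn n}
    (hu : ∀ i, DifferentiableAt ℂ (u i) m) (k : ℕ) :
    LinearMap.range (PTilde u m p k) ≤ koszulKer n p k := by
  rintro _ ⟨⟨w, hw⟩, rfl⟩
  rw [mem_closedColumns] at hw
  set θ : Fin d → homMaps q k (AltForm q p) := fun i =>
    (formJetEquiv q p k).symm fun AK => w (i, AK)
  have hwθ : ∀ i, formJet q p k (θ i) = fun AK => w (i, AK) := fun i =>
    (formJetEquiv q p k).apply_symm_apply _
  have h2 : w = fun iAK => formJet q p k (θ iAK.1) iAK.2 := by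
    funext ⟨i, AK⟩
    rw [hwθ]
  change (P u m p k).mulVec w ∈ _
  rw [h2, P_mulVec_formJet hu]
  refine Submodule.sum_mem _ fun i _ => ?_
  rw [formJet_mem_koszulKer_iff]
  intro x
  have h3 := hw i
  rw [← hwθ, formJet_mem_koszulKer_iff] at h3
  rw [extDeriv_linPullback _ (θ i).2.1, h3]
  rfl

end Relations

/-! ### Basic forms of a foliation by parallel affine subspaces -/

section Constant

variable {n p : ℕ}

theorem fderiv_form_apply {ω : Form n p} {x : Cn n} (hω : DifferentiableAt ℂ ω x) (v : Cn n)
    (w : Fin p → Cn n) : fderiv ℂ ω x v w = fderiv ℂ (fun y => ω y w) x v := by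
  have h := (evalForm w).hasFDerivAt.comp x hω.hasFDerivAt
  rw [show (fun y => ω y w) = evalForm w ∘ ω from rfl, h.fderiv]
  rfl

theorem kills_fderiv {T : Submodule ℂ (Cn n)} {ω : Form n p} {x : Cn n}
    (hω : DifferentiableAt ℂ ω x) (h : ∀ᶠ y in 𝓝 x, Kills T (ω y)) (v : Cn n) :
    Kills T (fderiv ℂ ω x v) := by
  intro w hw
  have h1 : (fun y => ω y w) =ᶠ[𝓝 x] fun _ => 0 := h.mono fun y hy => hy w hw
  rw [fderiv_form_apply hω, h1.fderiv_eq]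
  simp

theorem fderiv_eq_zero_of_mem_basicForms {T : Submodule ℂ (Cn n)} {cl : Prop} {k : ℕ}
    {θ : Form n p} (hθ : θ ∈ basicForms p T cl k) (x : Cn n) {v : Cn n} (hv : v ∈ T) :
    fderiv ℂ θ x v = 0 := by
  have h := hasDerivAt_line (x := x) (v := v) (z := 0) (hθ.1.1.differentiableAt)
  have h1 : (fun z : ℂ => θ (x + z • v)) = fun _ => θ x :=
    funext fun z => hθ.2.2.1 x _ (T.smul_mem z hv)
  rw [h1] at h
  simpa using h.unique (hasDerivAt_const _ _)

/-- If one argument of dθ lies in T, each term either differentiates along it, giving zero by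
invariance, or feeds it to a derivative of θ, which T still kills. -/
theorem isBasicAt_of_mem_basicForms {T : Submodule ℂ (Cn n)} {cl : Prop} {k : ℕ}
    {θ : Form n p} (hθ : θ ∈ basicForms p T cl k) (x : Cn n) : IsBasicAt (fun _ => T) θ x := by
  refine ⟨hθ.1.1 x, hθ.2.1 x, ?_⟩
  rintro w ⟨j, hj⟩
  rw [extDeriv_apply_eq_sum]
  refine Finset.sum_eq_zero fun i _ => ?_
  by_cases hij : i = j
  · rw [hij, fderiv_eq_zero_of_mem_basicForms hθ x hj]
    simp
  · obtain ⟨l, hl⟩ := Fin.exists_succAbove_eq (Ne.symm hij)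
    rw [kills_fderiv (hθ.1.1 x) (.of_forall hθ.2.1) (w i) (i.removeNth w)
      ⟨l, by rwa [Fin.removeNth_apply, hl]⟩, mul_zero]

/-- In dω(v, w) every term except the derivative along v has v as an argument of a derivative of ω,
hence vanishes. -/
theorem fderiv_eq_zero_of_isBasicAt {T : Submodule ℂ (Cn n)} {ω : Form n p} {x : Cn n}
    (h : ∀ᶠ y in 𝓝 x, IsBasicAt (fun _ => T) ω y) {v : Cn n} (hv : v ∈ T) : fderiv ℂ ω x v = 0 := by
  have hx := h.self_of_nhds
  ext w
  have h1 := hx.2.2 (Matrix.vecCons v w) ⟨0, by simpa using hv⟩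
  rw [extDeriv_apply_eq_sum, Fin.sum_univ_succ, Finset.sum_eq_zero, add_zero] at h1
  · have h4 : Fin.removeNth 0 (Matrix.vecCons v w) = w := by
      funext i; simp [Fin.removeNth_apply]
    rw [h4] at h1
    simpa using h1
  · intro j _
    cases p with
    | zero => exact j.elim0
    | succ p =>
      rw [kills_fderiv hx.1 (h.mono fun y hy => hy.2.1) _ (j.succ.removeNth (Matrix.vecCons v w))
        ⟨0, by simpa [Fin.removeNth_apply] using hv⟩, mul_zero]

/-- The form is constant along the segment from y to y + v, which stays in the ball by convexity. -/
theorem exists_ball_invariant {T : Submodule ℂ (Cn n)} {ω : Form n p}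
    (h : ∀ᶠ y in 𝓝 0, IsBasicAt (fun _ => T) ω y) :
    ∃ R > 0, ∀ y ∈ Metric.ball (0 : Cn n) R, ∀ v ∈ T, y + v ∈ Metric.ball (0 : Cn n) R →
      ω (y + v) = ω y := by
  obtain ⟨R, hR, hb⟩ := Metric.eventually_nhds_iff_ball.1 h.eventually_nhds
  refine ⟨R, hR, fun y hy v hv hyv => ?_⟩
  set s : Set ℂ := {t | y + t • v ∈ Metric.ball (0 : Cn n) R} with hs
  have hconv : Convex ℝ s := by
    intro t ht t' ht' a b ha hb hab
    have h1 := (convex_ball (0 : Cn n) R) ht ht' ha hb hab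
    rw [hs, Set.mem_ofPred_eq]
    convert h1 using 1
    have h2 : y = a • y + b • y := by rw [← add_smul, hab, one_smul]
    nth_rewrite 1 [h2]
    rw [add_smul, smul_add, smul_add, smul_assoc, smul_assoc]
    abel
  have hd : ∀ t ∈ s, HasDerivWithinAt (fun t : ℂ => ω (y + t • v)) 0 s t := by
    intro t ht
    have h1 := hasDerivAt_line (x := y) (v := v) (z := t) (hb _ ht).self_of_nhds.1
    rw [fderiv_eq_zero_of_isBasicAt (hb _ ht) hv] at h1
    exact h1.hasDerivWithinAt
  have h2 := hconv.norm_image_sub_le_of_norm_hasDerivWithin_le (C := 0) hd (by simp)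
    (x := 0) (y := 1) (by simpa [hs] using hy) (by simpa [hs] using hyv)
  simp only [one_smul, zero_smul, add_zero, zero_mul, norm_le_zero_iff] at h2
  exact sub_eq_zero.1 h2

theorem extDeriv_coordVec (ω : Form n p) (x : Cn n) (C : Increasing (p + 1) n) :
    extDeriv ω x (coordVec C) = ∑ j : Fin (p + 1), ((-1 : ℂ) ^ (j : ℕ) •
      evalForm (coordVec ((Fin.succAboveOrderEmb j).trans C)) :
        AltForm n p →L[ℂ] ℂ) (coordDeriv (C j) ω x) := by
  rw [extDeriv_apply_eq_sum]
  exact Finset.sum_congr rfl fun j _ => rfl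

theorem taylorPart_zero {V : Type*} [NormedAddCommGroup V] [NormedSpace ℂ V]
    [FiniteDimensional ℂ V] (k : ℕ) (x : Cn n) : taylorPart k (0 : Cn n → V) x = 0 :=
  taylorPart_sum_clm (∅ : Finset Unit) (fun _ => ContinuousLinearMap.id ℂ V) k
    (f := fun _ => 0) (by simp) x

/-- The exterior derivative of the part of degree k + 1 is the part of degree k of dω, checked
coefficient by coefficient. -/
theorem extDeriv_taylorPart {ω : Form n p} (hd : ∀ᶠ y in 𝓝 0, DifferentiableAt ℂ ω y)
    (h : ∀ᶠ y in 𝓝 0, extDeriv ω y = 0) (k : ℕ) (x : Cn n) :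
    extDeriv (taylorPart k ω) x = 0 := by
  cases k with
  | zero => exact extDeriv_of_mem_homMaps_zero (taylorPart_mem_homMaps 0 ω) x
  | succ k =>
    refine altForm_ext fun C => ?_
    rw [extDeriv_coordVec]
    simp only [coordDeriv_taylorPart k hd]
    rw [← taylorPart_sum_clm Finset.univ _ k (f := fun j => coordDeriv (C j) ω)
      fun j _ => eventually_differentiableAt_coordDeriv hd (C j)]
    have h1 : (fun y => ∑ j : Fin (p + 1), ((-1 : ℂ) ^ (j : ℕ) •
        evalForm (coordVec ((Fin.succAboveOrderEmb j).trans C)) :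
          AltForm n p →L[ℂ] ℂ) (coordDeriv (C j) ω y)) =ᶠ[𝓝 0] 0 := by
      filter_upwards [h] with y hy
      rw [← extDeriv_coordVec, hy]
      rfl
    rw [taylorPart_congr h1]
    simpa using taylorPart_zero (V := ℂ) k x

theorem taylorPart_mem_basicForms {T : Submodule ℂ (Cn n)} {cl : Prop} {ω : Form n p}
    (h : ∀ᶠ y in 𝓝 0, IsBasicAt (fun _ => T) ω y)
    (hcl : cl → ∀ᶠ y in 𝓝 0, extDeriv ω y = 0) (k : ℕ) :
    taylorPart k ω ∈ basicForms p T cl k := by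
  have hd : ∀ᶠ y in 𝓝 0, DifferentiableAt ℂ ω y := h.mono fun y hy => hy.1
  refine ⟨taylorPart_mem_homMaps k ω, fun x w hw => ?_, fun x v hv => ?_, fun hc x =>
    extDeriv_taylorPart hd (hcl hc) k x⟩
  · have h1 := taylorPart_sum_clm (Finset.univ : Finset Unit) (fun _ => evalForm w) k
      (f := fun _ => ω) (fun _ _ => hd) x
    have h2 : (fun y => ∑ _i : Unit, evalForm w (ω y)) =ᶠ[𝓝 0] 0 := by
      filter_upwards [h] with y hy
      simpa using hy.2.1 w hw
    rw [taylorPart_congr h2, taylorPart_zero] at h1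
    simpa using h1.symm
  -- Invariance is known only near 0, but the k-th derivatives at z = 0 of ω(z(x + v)) and ω(zx) see
  -- only small z. They determine the Taylor part at x + v and at x for all x.
  · obtain ⟨R, hR, hinv⟩ := exists_ball_invariant h
    have hball : ∀ y : Cn n, ∀ᶠ z : ℂ in 𝓝 0, z • y ∈ Metric.ball (0 : Cn n) R := by
      intro y
      have hc : Continuous fun z : ℂ => z • y := by fun_prop
      exact hc.continuousAt.eventually_mem (by simpa using Metric.ball_mem_nhds (0 : Cn n) hR)
    have h1 : (fun z : ℂ => ω (z • (x + v))) =ᶠ[𝓝 0] fun z => ω (z • x) := by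
      filter_upwards [hball x, hball (x + v)] with z hz hz'
      rw [smul_add] at hz' ⊢
      exact hinv _ hz _ (T.smul_mem z hv) hz'
    have h2 := h1.iteratedDeriv_eq k
    rw [iteratedDeriv_line k hd, iteratedDeriv_line k hd] at h2
    exact smul_right_injective _ (by exact_mod_cast k.factorial_ne_zero) h2

theorem taylorPart_mem_homRelations {d : ℕ} {T : Fin d → Submodule ℂ (Cn n)} {cl : Prop}
    {ω : Fin d → Form n p} (h : ∀ i, ∀ᶠ y in 𝓝 0, IsBasicAt (fun _ => T i) (ω i) y)
    (hcl : cl → ∀ i, ∀ᶠ y in 𝓝 0, extDeriv (ω i) y = 0)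
    (hsum : ∀ᶠ y in 𝓝 0, ∑ i, ω i y = 0) (k : ℕ) :
    (fun i => taylorPart k (ω i)) ∈ homRelations p T cl k := by
  refine ⟨fun i => taylorPart_mem_basicForms (h i) (fun hc => hcl hc i) k, ?_⟩
  funext x
  have h1 := taylorPart_sum_clm Finset.univ (fun _ : Fin d => ContinuousLinearMap.id ℂ _) k
    (f := ω) (fun i _ => (h i).mono fun y hy => hy.1) x
  have h2 : (fun y => ∑ i, ContinuousLinearMap.id ℂ (AltForm n p) (ω i y)) =ᶠ[𝓝 0] 0 := by
    filter_upwards [hsum] with y hy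
    simpa using hy
  rw [taylorPart_congr h2, taylorPart_zero] at h1
  rw [Finset.sum_apply]
  exact h1.symm

/-- Homogeneous forms of different degrees are linearly independent near the origin. -/
theorem eq_zero_of_sum_homMaps {N : ℕ} {θ : Fin N → Form n p}
    (hθ : ∀ k : Fin N, θ k ∈ homMaps n k (AltForm n p))
    (h : ∀ᶠ y in 𝓝 0, ∑ k, θ k y = 0) (k : Fin N) : θ k = 0 := by
  funext x
  ext w
  have hc : Continuous fun z : ℂ => z • x := by fun_prop
  have h1 : ∀ᶠ z : ℂ in 𝓝 0, ∑ k, θ k (z • x) = 0 :=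
    (show Filter.Tendsto (fun z : ℂ => z • x) (𝓝 0) (𝓝 0) by simpa using hc.tendsto 0).eventually h
  -- Along the line through x the sum is a polynomial in z vanishing near 0, so all its coefficients
  -- vanish.
  set Q : Polynomial ℂ := ∑ k : Fin N, Polynomial.C (θ k x w) * Polynomial.X ^ (k : ℕ) with hQ
  have h2 : Q = 0 := by
    refine Polynomial.eq_zero_of_infinite_isRoot Q ((infinite_of_mem_nhds (0 : ℂ) h1).mono ?_)
    intro z hz
    have h3 := congrArg (evalForm w) (show ∑ k, θ k (z • x) = 0 from hz)
    simp only [map_sum, map_zero, (hθ _).2, map_smul, evalForm_apply, smul_eq_mul] at h3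
    simp only [Set.mem_ofPred_eq, Polynomial.IsRoot, hQ, Polynomial.eval_finsetSum,
      Polynomial.eval_mul, Polynomial.eval_C, Polynomial.eval_pow, Polynomial.eval_X]
    rw [← h3]
    exact Finset.sum_congr rfl fun _ _ => mul_comm _ _
  have h4 := congrArg (fun R : Polynomial ℂ => R.coeff k) h2
  simp only [hQ, Polynomial.finsetSum_coeff, Polynomial.coeff_C_mul_X_pow,
    Polynomial.coeff_zero, Fin.val_inj] at h4
  simpa using h4

end Constant

/-! ### Straightening a parallelizable web -/

section Straightening

variable {n p q d : ℕ}

/-- `ψ` is a holomorphic chart centered at `m`, with inverse `χ`, which maps the foliations with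
tangent spaces `T i` to foliations by parallel affine subspaces. -/
structure IsStraightening (T : Fin d → Cn n → Submodule ℂ (Cn n)) (m : Cn n)
    (ψ χ : Cn n → Cn n) : Prop where
  map_center : ψ m = 0
  symm_zero : χ 0 = m
  differentiable : ∀ᶠ x in 𝓝 m, DifferentiableAt ℂ ψ x
  symm_differentiable : ∀ᶠ y in 𝓝 0, DifferentiableAt ℂ χ y
  left_inv : ∀ᶠ x in 𝓝 m, χ (ψ x) = x
  right_inv : ∀ᶠ y in 𝓝 0, ψ (χ y) = y
  tangent_eq : ∀ᶠ x in 𝓝 m, ∀ i, T i x = (T i m).comap (fderiv ℂ ψ x).toLinearMap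

/-- The chart is A(φ - φ(m)) with A inverse to dφ(m). Its differential at m is the identity, so the
model subspaces are the tangent spaces at m themselves, whatever affine functions define the web. -/
theorem Web.IsParallelizable.exists_straightening {U : Set (Cn n)} {W : Web d n q U}
    (hW : W.IsParallelizable) {m : Cn n} (hm : m ∈ U) :
    ∃ ψ χ : Cn n → Cn n, IsStraightening (fun i => (W i).tangent) m ψ χ := by
  obtain ⟨φ, hmφ, hφ, hφs, a, ha⟩ := hW m hm
  have hφd : ∀ x ∈ φ.source, DifferentiableAt ℂ φ x := fun x hx =>
    hφ.differentiableAt (φ.open_source.mem_nhds hx)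
  have hφsd : ∀ y ∈ φ.target, DifferentiableAt ℂ φ.symm y := fun y hy =>
    hφs.differentiableAt (φ.open_target.mem_nhds hy)
  have hmt : φ m ∈ φ.target := φ.map_source hmφ
  set D := fderiv ℂ φ m with hD
  set A := fderiv ℂ φ.symm (φ m) with hA
  have hDA : D.comp A = ContinuousLinearMap.id ℂ (Cn n) := by
    have h1 : HasFDerivAt (φ ∘ φ.symm) (D.comp A) (φ m) := by
      refine HasFDerivAt.comp (φ m) ?_ (hφsd _ hmt).hasFDerivAt
      rw [φ.left_inv hmφ]
      exact (hφd m hmφ).hasFDerivAt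
    have h2 : φ ∘ φ.symm =ᶠ[𝓝 (φ m)] id := by
      filter_upwards [φ.open_target.mem_nhds hmt] with y hy
      exact φ.right_inv hy
    exact (h1.congr_of_eventuallyEq h2.symm).unique (hasFDerivAt_id _)
  have hDA' : ∀ v, D (A v) = v := fun v => congrArg (fun f : Cn n →L[ℂ] Cn n => f v) hDA
  have hAD' : ∀ v, A (D v) = v := by
    have hAi : Function.Injective A := fun v w h => by rw [← hDA' v, h, hDA']
    have hAs : Function.Surjective A := LinearMap.injective_iff_surjective.1
      (show Function.Injective A.toLinearMap from hAi)
    intro v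
    obtain ⟨w, rfl⟩ := hAs v
    rw [hDA']
  have hsource := φ.open_source.mem_nhds hmφ
  have htarget : ∀ᶠ y in 𝓝 (0 : Cn n), φ m + D y ∈ φ.target := by
    have hc : Continuous fun y => φ m + D y := by fun_prop
    exact hc.continuousAt.eventually_mem (by simpa using φ.open_target.mem_nhds hmt)
  have hψ : ∀ x ∈ φ.source, HasFDerivAt (fun x => A (φ x - φ m)) (A.comp (fderiv ℂ φ x)) x :=
    fun x hx => A.hasFDerivAt.comp x ((hφd x hx).hasFDerivAt.sub_const _)
  have htan : ∀ᶠ x in 𝓝 m, ∀ i v, v ∈ (W i).tangent x ↔ (a i).linear (fderiv ℂ φ x v) = 0 := by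
    have h1 : ∀ᶠ x in 𝓝 m, ∀ i, LinearMap.ker (fderiv ℂ (fun x => a i (φ x)) x).toLinearMap =
        (W i).tangent x := Filter.eventually_all.2 fun i => (ha i).mono fun x hx => hx.2.2
    filter_upwards [h1, hsource] with x hx hxs i v
    have h2 : HasFDerivAt (fun x => a i (φ x))
        ((a i).linear.toContinuousLinearMap.comp (fderiv ℂ φ x)) x := by
      have h3 : (fun x => a i (φ x)) = fun x => (a i).linear.toContinuousLinearMap (φ x) + a i 0 :=
        funext fun x => congrFun (a i).decomp (φ x)
      rw [h3]
      exact ((a i).linear.toContinuousLinearMap.hasFDerivAt.comp x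
        (hφd x hxs).hasFDerivAt).add_const _
    rw [← hx i, h2.fderiv]
    rfl
  refine ⟨fun x => A (φ x - φ m), fun y => φ.symm (φ m + D y), by simp, ?_, ?_, ?_, ?_, ?_, ?_⟩
  · simp [φ.left_inv hmφ]
  · filter_upwards [hsource] with x hx
    exact (hψ x hx).differentiableAt
  · filter_upwards [htarget] with y hy
    exact (hφsd _ hy).comp y (D.differentiableAt.const_add _)
  · filter_upwards [hsource] with x hx
    simp [hDA', φ.left_inv hx]
  · filter_upwards [htarget] with y hy
    simp [φ.right_inv hy, hAD']
  · filter_upwards [htan, hsource] with x hx hxs i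
    ext v
    rw [Submodule.mem_comap, hx i v, htan.self_of_nhds i, (hψ x hxs).fderiv]
    change _ ↔ (a i).linear (D (A (fderiv ℂ φ x v))) = 0
    rw [hDA']

/-- The pullback of a form by a holomorphic map. -/
def formPullback (ψ : Cn n → Cn n) (ω : Form n p) : Form n p := fun x =>
  (ω (ψ x)).compContinuousLinearMap (fderiv ℂ ψ x)

theorem extDeriv_formPullback {ψ : Cn n → Cn n} {ω : Form n p} {x : Cn n}
    (hψ : ∀ᶠ y in 𝓝 x, DifferentiableAt ℂ ψ y) (hω : DifferentiableAt ℂ ω (ψ x)) :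
    extDeriv (formPullback ψ ω) x =
      (extDeriv ω (ψ x)).compContinuousLinearMap (fderiv ℂ ψ x) :=
  extDeriv_pullback hω (contDiffAt_of_eventually_differentiableAt hψ 2) (by simp)

theorem Kills.comp {r : ℕ} {S S' : Submodule ℂ (Cn n)} {η : AltForm n r} (h : Kills S η)
    {Λ : Cn n →L[ℂ] Cn n} (hΛ : ∀ v ∈ S', Λ v ∈ S) : Kills S' (η.compContinuousLinearMap Λ) :=
  fun w ⟨j, hj⟩ => h (fun i => Λ (w i)) ⟨j, hΛ _ hj⟩

theorem IsBasicAt.formPullback {T T' : Cn n → Submodule ℂ (Cn n)} {ψ : Cn n → Cn n}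
    {ω : Form n p} {x : Cn n} (h : IsBasicAt T ω (ψ x))
    (hψ : ∀ᶠ y in 𝓝 x, DifferentiableAt ℂ ψ y)
    (hT : ∀ v ∈ T' x, fderiv ℂ ψ x v ∈ T (ψ x)) : IsBasicAt T' (formPullback ψ ω) x := by
  refine ⟨?_, h.2.1.comp hT, ?_⟩
  · exact DifferentiableAt.continuousAlternatingMapCompContinuousLinearMap
      (f := fun x => ω (ψ x)) (g := fderiv ℂ ψ) (h.1.comp x hψ.self_of_nhds)
      (differentiableAt_fderiv hψ)
  · rw [extDeriv_formPullback hψ h.1]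
    exact h.2.2.comp hT

/-- The germ at `m` of the pullback of a family of forms. -/
def pullbackGerm (ψ : Cn n → Cn n) (m : Cn n) :
    (Fin d → Form n p) →ₗ[ℂ] (Fin d → FormGerm n p m) where
  toFun θ i := (formPullback ψ (θ i) : FormGerm n p m)
  map_add' _ _ := rfl
  map_smul' _ _ := rfl

/-- The germs of abelian relations, closed if `cl` holds. -/
def relationGerms {U : Set (Cn n)} (W : Web d n q U) (p : ℕ) (m : Cn n) (cl : Prop) :
    Submodule ℂ (Fin d → FormGerm n p m) :=
  open scoped Classical in
  if cl then W.closedAbelianRelations p m else W.abelianRelations p m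

theorem mem_relationGerms {U : Set (Cn n)} {W : Web d n q U} {m : Cn n} {cl : Prop}
    {g : Fin d → FormGerm n p m} :
    g ∈ relationGerms W p m cl ↔ ∃ ω : Fin d → Form n p, (∀ i, g i = (ω i : FormGerm n p m)) ∧
      ∀ᶠ x in 𝓝 m, (∀ i, IsBasicAt (W i).tangent (ω i) x ∧ (cl → extDeriv (ω i) x = 0)) ∧
        ∑ i, ω i x = 0 := by
  by_cases hc : cl
  · simp only [relationGerms, hc, if_true, true_imp_iff]
    rfl
  · simp only [relationGerms, hc, if_false, false_imp_iff, and_true]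
    rfl

/-- The germ of abelian relation defined by homogeneous relations of degrees `0, …, N - 1`. -/
def germOfRelations (T : Fin d → Submodule ℂ (Cn n)) (p : ℕ) (cl : Prop) (ψ : Cn n → Cn n)
    (m : Cn n) (N : ℕ) :
    (∀ k : Fin N, homRelations p T cl k) →ₗ[ℂ] (Fin d → FormGerm n p m) :=
  pullbackGerm ψ m ∘ₗ ∑ k : Fin N, (homRelations p T cl k).subtype ∘ₗ LinearMap.proj k

theorem germOfRelations_apply {T : Fin d → Submodule ℂ (Cn n)} {cl : Prop} {ψ : Cn n → Cn n}
    {m : Cn n} {N : ℕ} (θ : ∀ k : Fin N, homRelations p T cl k) (i : Fin d) :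
    germOfRelations T p cl ψ m N θ i =
      (formPullback ψ (fun y => ∑ k, (θ k).1 i y) : FormGerm n p m) := by
  have h : (∑ k, (θ k).1) i = fun y => ∑ k, (θ k).1 i y := by
    funext y
    simp
  have h' : germOfRelations T p cl ψ m N θ = pullbackGerm ψ m (∑ k, (θ k).1) := by
    simp [germOfRelations]
  rw [h', ← h]
  rfl

variable {U : Set (Cn n)} {W : Web d n q U} {m : Cn n} {ψ χ : Cn n → Cn n}

theorem IsStraightening.tendsto (h : IsStraightening (fun i => (W i).tangent) m ψ χ) :
    Filter.Tendsto ψ (𝓝 m) (𝓝 0) := by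
  have := h.differentiable.self_of_nhds.continuousAt.tendsto
  rwa [h.map_center] at this

theorem IsStraightening.tendsto_symm (h : IsStraightening (fun i => (W i).tangent) m ψ χ) :
    Filter.Tendsto χ (𝓝 0) (𝓝 m) := by
  have := h.symm_differentiable.self_of_nhds.continuousAt.tendsto
  rwa [h.symm_zero] at this

/-- The differentials of `ψ` and `χ` are inverse to each other. -/
theorem IsStraightening.fderiv_right_inv (h : IsStraightening (fun i => (W i).tangent) m ψ χ) :
    ∀ᶠ y in 𝓝 0, ∀ v, fderiv ℂ ψ (χ y) (fderiv ℂ χ y v) = v := by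
  filter_upwards [h.right_inv.eventually_nhds, h.symm_differentiable,
    h.tendsto_symm.eventually h.differentiable] with y hy hd hd' v
  have h1 := (hd'.hasFDerivAt.comp y hd.hasFDerivAt).congr_of_eventuallyEq
    (f₁ := id) (hy.mono fun z hz => hz.symm)
  exact congrArg (fun f : Cn n →L[ℂ] Cn n => f v) (h1.unique (hasFDerivAt_id y))

theorem IsStraightening.fderiv_left_inv (h : IsStraightening (fun i => (W i).tangent) m ψ χ) :
    ∀ᶠ x in 𝓝 m, ∀ v, fderiv ℂ χ (ψ x) (fderiv ℂ ψ x v) = v := by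
  filter_upwards [h.left_inv.eventually_nhds, h.differentiable,
    h.tendsto.eventually h.symm_differentiable] with x hx hd hd' v
  have h1 := (hd'.hasFDerivAt.comp x hd.hasFDerivAt).congr_of_eventuallyEq
    (f₁ := id) (hx.mono fun z hz => hz.symm)
  exact congrArg (fun f : Cn n →L[ℂ] Cn n => f v) (h1.unique (hasFDerivAt_id x))

/-- Pulling back by χ undoes ψ near 0, and homogeneous forms of different degrees are independent
there. -/
theorem germOfRelations_injective (h : IsStraightening (fun i => (W i).tangent) m ψ χ)
    (cl : Prop) (N : ℕ) :
    Function.Injective (germOfRelations (fun i => (W i).tangent m) p cl ψ m N) := by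
  refine (injective_iff_map_eq_zero _).2 fun θ hθ => ?_
  funext k
  apply Subtype.ext
  funext i
  refine eq_zero_of_sum_homMaps (θ := fun k => (θ k).1 i) (fun k => ((θ k).2.1 i).1) ?_ k
  have h1 := congrFun hθ i
  rw [germOfRelations_apply] at h1
  have h2 : formPullback ψ (fun y => ∑ k, (θ k).1 i y) =ᶠ[𝓝 m] 0 := Filter.Germ.coe_eq.1 h1
  filter_upwards [h.tendsto_symm.eventually h2, h.right_inv, h.fderiv_right_inv] with y hy hr hd
  ext w
  have h3 := congrArg (fun η : AltForm n p => η fun j => fderiv ℂ χ y (w j)) hy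
  simpa [formPullback, Function.comp_def, hd, hr] using h3

theorem germOfRelations_mem (h : IsStraightening (fun i => (W i).tangent) m ψ χ)
    (cl : Prop) (N : ℕ) (θ : ∀ k : Fin N, homRelations p (fun i => (W i).tangent m) cl k) :
    germOfRelations (fun i => (W i).tangent m) p cl ψ m N θ ∈ relationGerms W p m cl := by
  rw [mem_relationGerms]
  refine ⟨_, germOfRelations_apply θ, ?_⟩
  have hfun : ∀ i, (fun y => ∑ k, (θ k).1 i y) = ∑ k, (θ k).1 i := fun i => by
    funext y; simp
  have hbasic : ∀ i y, IsBasicAt (fun _ => (W i).tangent m) (fun y => ∑ k, (θ k).1 i y) y := by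
    intro i y
    rw [hfun]
    exact Finset.sum_induction _ (fun ω => IsBasicAt (fun _ => (W i).tangent m) ω y)
      (fun _ _ h h' => h.add h') (IsBasicAt.zero _ y)
      fun k _ => isBasicAt_of_mem_basicForms ((θ k).2.1 i) y
  have hclosed : cl → ∀ i y, extDeriv (fun y => ∑ k, (θ k).1 i y) y = 0 := by
    intro hc i y
    rw [hfun]
    refine (Finset.sum_induction _ (fun ω : Form n p => DifferentiableAt ℂ ω y ∧
      extDeriv ω y = 0) (fun ω ω' h h' => ⟨h.1.add h'.1, ?_⟩)
      ⟨differentiableAt_const _, extDeriv_zero_form y⟩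
      fun k _ => ⟨((θ k).2.1 i).1.1 y, ((θ k).2.1 i).2.2.2 hc y⟩).2
    rw [extDeriv_add h.1 h'.1, h.2, h'.2, add_zero]
  filter_upwards [h.differentiable.eventually_nhds, h.tangent_eq] with x hx hT
  refine ⟨fun i => ⟨(hbasic i _).formPullback hx fun v hv => ?_, fun hc => ?_⟩, ?_⟩
  · rw [hT i] at hv
    exact hv
  · rw [extDeriv_formPullback hx (hbasic i _).1, hclosed hc]
    rfl
  · ext w
    have h1 : ∀ k : Fin N, ∑ i, (θ k).1 i (ψ x) = 0 := fun k => by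
      simpa using congrFun (θ k).2.2 (ψ x)
    have h2 : ∑ i, ∑ k, (θ k).1 i (ψ x) = 0 := by
      rw [Finset.sum_comm]
      exact Finset.sum_eq_zero fun k _ => h1 k
    have h3 := congrArg (fun η : AltForm n p => η fun j => fderiv ℂ ψ x (w j)) h2
    simpa [formPullback, Function.comp_def, ContinuousAlternatingMap.sum_apply] using h3

/-- Transported by χ, the relation has homogeneous relations as Taylor parts. Those of degree at
least N vanish, so it equals a finite sum of them near 0. -/
theorem exists_germOfRelations_eq (h : IsStraightening (fun i => (W i).tangent) m ψ χ)
    {cl : Prop} {N : ℕ}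
    (hN : ∀ k, N ≤ k → homRelations p (fun i => (W i).tangent m) cl k = ⊥)
    {g : Fin d → FormGerm n p m} (hg : g ∈ relationGerms W p m cl) :
    ∃ θ, germOfRelations (fun i => (W i).tangent m) p cl ψ m N θ = g := by
  rw [mem_relationGerms] at hg
  obtain ⟨ω, hgω, hω⟩ := hg
  set ω' : Fin d → Form n p := fun i => formPullback χ (ω i) with hω'
  have h0 : ∀ᶠ y in 𝓝 0, (∀ i, IsBasicAt (fun _ => (W i).tangent m) (ω' i) y ∧
      (cl → extDeriv (ω' i) y = 0)) ∧ ∑ i, ω' i y = 0 := by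
    filter_upwards [h.tendsto_symm.eventually hω, h.symm_differentiable.eventually_nhds,
      h.fderiv_right_inv, h.tendsto_symm.eventually h.tangent_eq] with y hy hd hinv hT
    refine ⟨fun i => ⟨(hy.1 i).1.formPullback hd fun v hv => ?_, fun hc => ?_⟩, ?_⟩
    · rw [hT i, Submodule.mem_comap]
      change fderiv ℂ ψ (χ y) (fderiv ℂ χ y v) ∈ _
      rwa [hinv]
    · rw [extDeriv_formPullback hd (hy.1 i).1.1, (hy.1 i).2 hc]
      rfl
    · ext w
      have h3 := congrArg (fun η : AltForm n p => η fun j => fderiv ℂ χ y (w j)) hy.2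
      simpa [hω', formPullback, Function.comp_def, ContinuousAlternatingMap.sum_apply] using h3
  have hmem : ∀ k, (fun i => taylorPart k (ω' i)) ∈
      homRelations p (fun i => (W i).tangent m) cl k := fun k =>
    taylorPart_mem_homRelations (fun i => h0.mono fun y hy => (hy.1 i).1)
      (fun hc i => h0.mono fun y hy => (hy.1 i).2 hc) (h0.mono fun y hy => hy.2) k
  have hvan : ∀ k, N ≤ k → ∀ i, taylorPart k (ω' i) = 0 := fun k hk i => by
    have h1 := hmem k
    rw [hN k hk, Submodule.mem_bot] at h1
    exact congrFun h1 i
  have hsum : ∀ i, ∀ᶠ y in 𝓝 0, ∑ k : Fin N, taylorPart k (ω' i) y = ω' i y := by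
    intro i
    filter_upwards [eventually_hasSum_taylorPart (h0.mono fun y hy => (hy.1 i).1.1)] with y hy
    have h1 := hasSum_sum_of_ne_finset_zero (L := SummationFilter.unconditional ℕ) (f := fun k => taylorPart k (ω' i) y)
      (s := Finset.range N) fun k hk => by
        rw [hvan k (by simpa using hk)]
        rfl
    rw [← hy.unique h1 |>.symm, Finset.sum_range]
  refine ⟨fun k => ⟨_, hmem k⟩, funext fun i => ?_⟩
  rw [germOfRelations_apply, hgω i]
  refine Filter.Germ.coe_eq.2 ?_
  filter_upwards [h.tendsto.eventually (hsum i), h.left_inv, h.fderiv_left_inv] with x hx hl hd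
  ext w
  rw [formPullback, hx]
  simp [hω', formPullback, Function.comp_def, hd, hl]

/-- The dimension of the space of germs of abelian relations of a parallelizable web. -/
theorem rank_relationGerms_ge (h : IsStraightening (fun i => (W i).tangent) m ψ χ) (cl : Prop)
    [∀ k, FiniteDimensional ℂ (homRelations p (fun i => (W i).tangent m) cl k)] (N : ℕ) :
    ((∑ k ∈ Finset.range N, Module.finrank ℂ (homRelations p (fun i => (W i).tangent m) cl k) :
      ℕ) : Cardinal) ≤ Module.rank ℂ (relationGerms W p m cl) := by
  have h1 := LinearMap.rank_le_of_injective
    ((germOfRelations (fun i => (W i).tangent m) p cl ψ m N).codRestrict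
      (relationGerms W p m cl) (germOfRelations_mem h cl N))
    (fun θ θ' hθ => germOfRelations_injective h cl N (congrArg Subtype.val hθ))
  refine le_trans (le_of_eq ?_) h1
  have hfree : ∀ k : Fin N, Module.Free ℂ (homRelations p (fun i => (W i).tangent m) cl k) :=
    fun k => Module.Free.of_divisionRing ℂ (homRelations p (fun i => (W i).tangent m) cl k)
  rw [← Module.finrank_eq_rank, Module.finrank_pi_fintype, Finset.sum_range]

theorem rank_relationGerms_eq (h : IsStraightening (fun i => (W i).tangent) m ψ χ) (cl : Prop)
    [∀ k, FiniteDimensional ℂ (homRelations p (fun i => (W i).tangent m) cl k)] {N : ℕ}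
    (hN : ∀ k, N ≤ k →
      Module.finrank ℂ (homRelations p (fun i => (W i).tangent m) cl k) = 0) :
    Module.rank ℂ (relationGerms W p m cl) =
      ((∑ k ∈ Finset.range N,
        Module.finrank ℂ (homRelations p (fun i => (W i).tangent m) cl k) : ℕ) : Cardinal) := by
  refine le_antisymm ?_ (rank_relationGerms_ge h cl N)
  have h1 := LinearMap.rank_le_of_surjective
    ((germOfRelations (fun i => (W i).tangent m) p cl ψ m N).codRestrict
      (relationGerms W p m cl) (germOfRelations_mem h cl N))
    (fun g => by
      obtain ⟨θ, hθ⟩ := exists_germOfRelations_eq h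
        (fun k hk => Submodule.finrank_eq_zero.1 (hN k hk)) g.2
      exact ⟨θ, Subtype.ext hθ⟩)
  refine h1.trans (le_of_eq ?_)
  have hfree : ∀ k : Fin N, Module.Free ℂ (homRelations p (fun i => (W i).tangent m) cl k) :=
    fun k => Module.Free.of_divisionRing ℂ (homRelations p (fun i => (W i).tangent m) cl k)
  rw [← Module.finrank_eq_rank, Module.finrank_pi_fintype, Finset.sum_range]

end Straightening

/-! ### The bounds have finitely many terms -/

section Numbers

/-- The quotient of the two binomials is (N + 1)/(N + 1 - k). -/
theorem mul_choose_le_choose_succ {d N k : ℕ} (hk : k ≤ N) (h : d * (N + 1 - k) ≤ N + 1) :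
    d * N.choose k ≤ (N + 1).choose k := by
  have h1 := Nat.choose_mul_succ_eq N k
  have h2 : 0 < N + 1 - k := by omega
  refine Nat.le_of_mul_le_mul_right ?_ h2
  rw [← h1, mul_right_comm, mul_comm]
  exact Nat.mul_le_mul_left _ h

theorem exists_piZero_bound {p n d q : ℕ} (hq : 0 < q) (hqn : q < n) :
    ∃ N, ∀ k, N ≤ k → (d : ℤ) * (b q p * c q k : ℕ) ≤ (b n p * c n k : ℕ) := by
  -- Passing from q to q + 1 variables multiplies c(·, k) by (q + k)/q, which is at least d from
  -- here on.
  refine ⟨d * q, fun k hk => ?_⟩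
  norm_cast
  have h1 : d * c q k ≤ c n k := by
    have h2 : d * (q + k - 1).choose k ≤ (q + k - 1 + 1).choose k :=
      mul_choose_le_choose_succ (by omega) (by
        rw [show q + k - 1 + 1 - k = q by omega]; omega)
    exact h2.trans (Nat.choose_le_choose k (by omega))
  calc d * (b q p * c q k) = b q p * (d * c q k) := by ring
    _ ≤ b n p * c n k := Nat.mul_le_mul (Nat.choose_le_choose p hqn.le) h1

theorem choose_mul_choose_add (N a e : ℕ) :
    N.choose (a + e) * (a + e).choose e = N.choose a * (N - a).choose e := by
  have h := Nat.choose_mul (n := N) (k := a + e) (s := a) (by omega)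
  rw [show a + e - a = e by omega] at h
  rw [← h, Nat.choose_symm_add]

/-- A product formula without signs, obtained from `z_succ` and Pascal's rule, makes the growth of z
in r comparable. -/
theorem z_eq_choose_mul_choose (r p k : ℕ) :
    z r (p + 1) k = (r + k).choose (k + p + 1) * (k + p).choose p := by
  induction k generalizing p with
  | zero => simp [z_zero, b]
  | succ k ih =>
    rw [z_succ, ih (p + 1), b, c, b]
    rcases r.eq_zero_or_pos with rfl | hr
    · simp [Nat.choose_eq_zero_of_lt (show k + 1 < k + 1 + p + 1 by omega),
        Nat.choose_eq_zero_of_lt (show k < k + (p + 1) + 1 by omega)]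
    · have h1 := choose_mul_choose_add (r + k) (k + 1) p
      have h2 := choose_mul_choose_add (r + k) (k + 1) (p + 1)
      rw [show r + k - (k + 1) = r - 1 by omega] at h1 h2
      have h3 : r.choose (p + 1) = (r - 1).choose p + (r - 1).choose (p + 1) := by
        conv_lhs => rw [show r = r - 1 + 1 by omega]
        exact Nat.choose_succ_succ _ _
      have h4 : (r + (k + 1)).choose (k + 1 + p + 1) =
          (r + k).choose (k + 1 + p) + (r + k).choose (k + 1 + (p + 1)) :=
        Nat.choose_succ_succ _ _
      have h5 : (k + 1 + (p + 1)).choose (p + 1) =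
          (k + 1 + p).choose p + (k + 1 + p).choose (p + 1) := Nat.choose_succ_succ _ _
      rw [h5] at h2
      rw [h3, h4, show r + (k + 1) - 1 = r + k by omega,
        show k + (p + 1) + 1 = k + 1 + (p + 1) by omega, show k + (p + 1) = k + 1 + p by omega]
      zify at h1 h2
      push_cast
      linear_combination -h1 - h2

theorem exists_piPrime_bound {p n d q : ℕ} (hp : 1 ≤ p) (hpq : p ≤ q) (hqn : q < n) :
    ∃ N, ∀ k, N ≤ k → (d : ℤ) * z q p k ≤ z n p k := by
  obtain ⟨p, rfl⟩ : ∃ p', p = p' + 1 := ⟨p - 1, by omega⟩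
  refine ⟨d * q, fun k hk => ?_⟩
  -- The second binomial does not depend on r, so only C(q + k, ·) and C(n + k, ·) remain to be
  -- compared.
  rw [z_eq_choose_mul_choose, z_eq_choose_mul_choose, ← mul_assoc]
  norm_cast
  refine Nat.mul_le_mul_right _ ?_
  refine (mul_choose_le_choose_succ (by omega) ?_).trans
    (Nat.choose_le_choose _ (by omega : q + k + 1 ≤ n + k))
  have : q + k + 1 - (k + p + 1) ≤ q := by omega
  have := Nat.mul_le_mul_left d this
  omega

end Numbers

/-! ### The ranks -/

section Ranks

theorem finsum_toNat_eq_sum {f : ℕ → ℤ} {N : ℕ} (hN : ∀ k, N ≤ k → f k ≤ 0) {M : ℕ}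
    (hM : N ≤ M) : ∑ᶠ k, (f k).toNat = ∑ k ∈ Finset.range M, (f k).toNat := by
  refine finsum_eq_sum_of_support_subset _ fun k hk => ?_
  by_contra hkM
  exact hk (Int.toNat_of_nonpos (hN k (hM.trans (by simpa using hkM))))

/-- The supremum of dimensions of spaces which are, roughly, the direct sums of spaces of
dimensions `a x k` bounded below. -/
theorem iSup_toENat_rank {X : Type*} {S : Set X} (hS : S.Nonempty) {a : X → ℕ → ℕ}
    {rk : X → Cardinal} {f : ℕ → ℤ}
    (hge : ∀ x ∈ S, ∀ N, ((∑ k ∈ Finset.range N, a x k : ℕ) : Cardinal) ≤ rk x)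
    (heq : ∀ x ∈ S, ∀ N, (∀ k, N ≤ k → a x k = 0) →
      rk x = ((∑ k ∈ Finset.range N, a x k : ℕ) : Cardinal))
    (hlow : ∀ x ∈ S, ∀ k, (f k).toNat ≤ a x k) (hfin : ∃ N, ∀ k, N ≤ k → f k ≤ 0) :
    ((∀ x ∈ S, ∀ k, a x k = (f k).toNat) →
      ⨆ x ∈ S, Cardinal.toENat (rk x) = ((∑ᶠ k, (f k).toNat : ℕ) : ℕ∞)) ∧
    (¬ (∀ x ∈ S, ∀ k, a x k = (f k).toNat) →
      ((∑ᶠ k, (f k).toNat : ℕ) : ℕ∞) < ⨆ x ∈ S, Cardinal.toENat (rk x)) := by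
  obtain ⟨N, hN⟩ := hfin
  constructor
  · intro h
    have h1 : ∀ x ∈ S, Cardinal.toENat (rk x) = ((∑ᶠ k, (f k).toNat : ℕ) : ℕ∞) := by
      intro x hx
      rw [heq x hx N fun k hk => by rw [h x hx, Int.toNat_of_nonpos (hN k hk)],
        finsum_toNat_eq_sum hN le_rfl, Cardinal.toENat_nat,
        Finset.sum_congr rfl fun k _ => h x hx k]
    rw [biSup_congr h1, biSup_const hS]
  · intro h
    push Not at h
    obtain ⟨x, hx, k, hk⟩ := h
    refine lt_of_lt_of_le ?_ (le_biSup (fun x => Cardinal.toENat (rk x)) hx)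
    -- M covers all positive terms of the bound and the degree k where the inequality is strict.
    -- Only the lower bound on the rank is used here, so an infinite rank is allowed.
    set M := max N (k + 1)
    have h1 : ∑ᶠ k, (f k).toNat < ∑ k ∈ Finset.range M, a x k := by
      rw [finsum_toNat_eq_sum hN (le_max_left N (k + 1))]
      exact Finset.sum_lt_sum (fun k _ => hlow x hx k)
        ⟨k, by simp, lt_of_le_of_ne (hlow x hx k) (Ne.symm hk)⟩
    calc ((∑ᶠ k, (f k).toNat : ℕ) : ℕ∞) < ((∑ k ∈ Finset.range M, a x k : ℕ) : ℕ∞) := by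
          exact_mod_cast h1
      _ ≤ Cardinal.toENat (rk x) := by
          rw [← Cardinal.toENat_nat]
          exact Cardinal.toENat.monotone' (hge x hx M)

variable {p n d q : ℕ} {U : Set (Cn n)} {W : Web d n q U} {m : Cn n}

theorem exists_isSystem (hm : m ∈ U) : ∃ u, W.IsSystem u m := by
  choose u hu using fun i => (W i).exists_system m hm
  exact ⟨u, hu⟩

theorem finrank_relations_add {u : Fin d → Cn n → Cn q} (hu : W.IsSystem u m) (cl : Prop) (k : ℕ) :
    FiniteDimensional ℂ (homRelations p (fun i => (W i).tangent m) cl k) ∧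
    Module.finrank ℂ (homRelations p (fun i => (W i).tangent m) cl k) +
      Module.finrank ℂ (LinearMap.range
        ((P u m p k).mulVecLin.domRestrict (columnSpace d q p k cl))) =
      Module.finrank ℂ (columnSpace d q p k cl) := by
  have h := finrank_homRelations_add (p := p) (fun i => (hu i).self_of_nhds.1)
    (fun i => (hu i).self_of_nhds.2.1) cl k
  rwa [show (fun i => LinearMap.ker (fderiv ℂ (u i) m).toLinearMap) = fun i => (W i).tangent m from
    funext fun i => (hu i).self_of_nhds.2.2] at h

theorem finrank_relations_add_rank {u : Fin d → Cn n → Cn q} (hu : W.IsSystem u m) (k : ℕ) :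
    Module.finrank ℂ (homRelations p (fun i => (W i).tangent m) False k) + (P u m p k).rank =
      d * (b q p * c q k) := by
  have h := (finrank_relations_add (p := p) hu False k).2
  rw [show columnSpace d q p k False = ⊤ from iInf_of_empty _, LinearMap.range_domRestrict,
    Submodule.map_top, finrank_top, Module.finrank_fintype_fun_eq_card, Fintype.card_prod,
    Fintype.card_prod, Fintype.card_fin, card_increasing, card_multiIndex] at h
  exact h

theorem finrank_closed_relations_add {u : Fin d → Cn n → Cn q} (hu : W.IsSystem u m) (k : ℕ) :
    (Module.finrank ℂ (homRelations p (fun i => (W i).tangent m) True k) : ℤ) +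
      Module.finrank ℂ (LinearMap.range (PTilde u m p k)) = d * z q p k := by
  have h := (finrank_relations_add (p := p) hu True k).2
  rw [show columnSpace d q p k True = closedColumns d q p k from iInf_pos trivial] at h
  rw [← finrank_closedColumns, ← h]
  push_cast
  rfl

theorem rank_P_le (u : Fin d → Cn n → Cn q) (m : Cn n) (p k : ℕ) :
    (P u m p k).rank ≤ b n p * c n k := by
  have h := (P u m p k).rank_le_card_height
  rwa [Fintype.card_prod, card_increasing, card_multiIndex] at h

theorem finrank_range_PTilde_le {u : Fin d → Cn n → Cn q} (hu : W.IsSystem u m) (p k : ℕ) :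
    (Module.finrank ℂ (LinearMap.range (PTilde u m p k)) : ℤ) ≤ z n p k := by
  rw [← finrank_koszulKer]
  exact_mod_cast Submodule.finrank_mono (range_PTilde_le (fun i => (hu i).self_of_nhds.1) k)

/-- The dimension of the relations is the number of columns minus the rank. It does not involve the
system u, so testing one system at m amounts to testing all of them. -/
theorem isOrdinary_iff : W.IsOrdinary p ↔ ∀ m ∈ U, ∀ k,
    Module.finrank ℂ (homRelations p (fun i => (W i).tangent m) False k) =
      ((d : ℤ) * (b q p * c q k : ℕ) - (b n p * c n k : ℕ)).toNat := by
  have key : ∀ m u, W.IsSystem u m → ∀ k, ((P u m p k).rank = min (b n p * c n k)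
      (d * (b q p * c q k)) ↔
      Module.finrank ℂ (homRelations p (fun i => (W i).tangent m) False k) =
      ((d : ℤ) * (b q p * c q k : ℕ) - (b n p * c n k : ℕ)).toNat) := by
    intro m u hu k
    have h1 := finrank_relations_add_rank (p := p) hu k
    have h2 := rank_P_le u m p k
    rw [← Nat.cast_mul]
    omega
  constructor
  · intro h m hm k
    obtain ⟨u, hu⟩ := exists_isSystem (W := W) hm
    exact (key m u hu k).1 (h m hm u hu k)
  · exact fun h m hm u hu k => (key m u hu k).2 (h m hm k)

theorem isStronglyOrdinary_iff : W.IsStronglyOrdinary p ↔ ∀ m ∈ U, ∀ k,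
    Module.finrank ℂ (homRelations p (fun i => (W i).tangent m) True k) =
      ((d : ℤ) * z q p k - z n p k).toNat := by
  have key : ∀ m u, W.IsSystem u m → ∀ k,
      ((Module.finrank ℂ (LinearMap.range (PTilde u m p k)) : ℤ) =
        min (z n p k) (d * z q p k) ↔
      Module.finrank ℂ (homRelations p (fun i => (W i).tangent m) True k) =
      ((d : ℤ) * z q p k - z n p k).toNat) := by
    intro m u hu k
    have h1 := finrank_closed_relations_add (p := p) hu k
    have h2 := finrank_range_PTilde_le hu p k
    omega
  constructor
  · intro h m hm k
    obtain ⟨u, hu⟩ := exists_isSystem (W := W) hm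
    exact (key m u hu k).1 (h m hm u hu k)
  · exact fun h m hm u hu k => (key m u hu k).2 (h m hm k)

/-- The rank of a parallelizable web in terms of its homogeneous abelian relations. -/
theorem Web.IsParallelizable.iSup_rank (hW : W.IsParallelizable) (hne : U.Nonempty) (cl : Prop)
    {f : ℕ → ℤ} (hfin : ∃ N, ∀ k, N ≤ k → f k ≤ 0)
    (hlow : ∀ m ∈ U, ∀ k, (f k).toNat ≤
      Module.finrank ℂ (homRelations p (fun i => (W i).tangent m) cl k)) :
    ((∀ m ∈ U, ∀ k, Module.finrank ℂ (homRelations p (fun i => (W i).tangent m) cl k) =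
        (f k).toNat) →
      ⨆ m ∈ U, Cardinal.toENat (Module.rank ℂ (relationGerms W p m cl)) =
        ((∑ᶠ k, (f k).toNat : ℕ) : ℕ∞)) ∧
    (¬ (∀ m ∈ U, ∀ k, Module.finrank ℂ (homRelations p (fun i => (W i).tangent m) cl k) =
        (f k).toNat) →
      ((∑ᶠ k, (f k).toNat : ℕ) : ℕ∞) <
        ⨆ m ∈ U, Cardinal.toENat (Module.rank ℂ (relationGerms W p m cl))) := by
  have hfd : ∀ m ∈ U, ∀ k,
      FiniteDimensional ℂ (homRelations p (fun i => (W i).tangent m) cl k) := fun m hm k => by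
    obtain ⟨u, hu⟩ := exists_isSystem (W := W) hm
    exact (finrank_relations_add hu cl k).1
  refine iSup_toENat_rank (a := fun m k =>
    Module.finrank ℂ (homRelations p (fun i => (W i).tangent m) cl k))
    (rk := fun m => Module.rank ℂ (relationGerms W p m cl)) hne ?_ ?_ hlow hfin
  · intro m hm N
    obtain ⟨ψ, χ, h⟩ := hW.exists_straightening hm
    have := hfd m hm
    exact rank_relationGerms_ge h cl N
  · intro m hm N hN
    obtain ⟨ψ, χ, h⟩ := hW.exists_straightening hm
    have := hfd m hm
    exact rank_relationGerms_eq h cl hN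

theorem relationGerms_false (m : Cn n) :
    relationGerms W p m False = W.abelianRelations p m :=
  if_neg not_false

theorem relationGerms_true (m : Cn n) :
    relationGerms W p m True = W.closedAbelianRelations p m :=
  if_pos trivial

theorem pRank_eq_iSup : W.pRank p =
    ⨆ m ∈ U, Cardinal.toENat (Module.rank ℂ (relationGerms W p m False)) :=
  iSup_congr fun m => iSup_congr fun _ => by rw [relationGerms_false]

theorem closedPRank_eq_iSup : W.closedPRank p =
    ⨆ m ∈ U, Cardinal.toENat (Module.rank ℂ (relationGerms W p m True)) :=
  iSup_congr fun m => iSup_congr fun _ => by rw [relationGerms_true]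

end Ranks

end AbelianWeb

end

theorem mainTheorem6 (p n d q : ℕ) (hp : 1 ≤ p) (hpq : p ≤ q) (hqn : q < n) (hd : 0 < d)
    (U : Set (AbelianWeb.Cn n)) (hU : IsOpen U) (hne : U.Nonempty)
    (W : AbelianWeb.Web d n q U) (hW : W.IsParallelizable) :
    ((W.IsOrdinary p → W.pRank p = (AbelianWeb.piZero p n d q : ℕ∞)) ∧
      (¬ W.IsOrdinary p → (AbelianWeb.piZero p n d q : ℕ∞) < W.pRank p)) ∧
    ((W.IsStronglyOrdinary p → W.closedPRank p = (AbelianWeb.piPrime p n d q : ℕ∞)) ∧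
      (¬ W.IsStronglyOrdinary p → (AbelianWeb.piPrime p n d q : ℕ∞) < W.closedPRank p)) := by
  open AbelianWeb in
  rw [isOrdinary_iff, isStronglyOrdinary_iff, pRank_eq_iSup, closedPRank_eq_iSup, piZero, piPrime]
  refine ⟨hW.iSup_rank hne False ?_ ?_, hW.iSup_rank hne True ?_ ?_⟩
  · obtain ⟨N, hN⟩ := AbelianWeb.exists_piZero_bound (p := p) (d := d) (hp.trans hpq) hqn
    exact ⟨N, fun k hk => sub_nonpos.2 (hN k hk)⟩
  · intro m hm k
    obtain ⟨u, hu⟩ := AbelianWeb.exists_isSystem (W := W) hm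
    have h1 := AbelianWeb.finrank_relations_add_rank (p := p) hu k
    have h2 := AbelianWeb.rank_P_le u m p k
    rw [← Nat.cast_mul]
    omega
  · obtain ⟨N, hN⟩ := AbelianWeb.exists_piPrime_bound (d := d) hp hpq hqn
    exact ⟨N, fun k hk => sub_nonpos.2 (hN k hk)⟩
  · intro m hm k
    obtain ⟨u, hu⟩ := AbelianWeb.exists_isSystem (W := W) hm
    have h1 := AbelianWeb.finrank_closed_relations_add (p := p) hu k
    have h2 := AbelianWeb.finrank_range_PTilde_le hu p k
    omega
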